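/- Let $a,d,e\in\mathbb R$ with $d>0$ be such that $P(x,y)=xy^2+ay-dx-e$ is irreducible in $\mathbb R[x,y]$, let $C=\{(x,y)\in\mathbb R^2: P(x,y)=0\}$ with vanishing ideal $I\subset\mathbb R[x,y]$, and let $\mathbb R[C]=\mathbb R[x,y]/I$, with $\mathbb R[C]_{\le m}$ the image of the polynomials $\mathbb R[x,y]_{\le m}$ of degree at most $m$. Let $k\ge 1$ and, in $\mathbb R[C]$, put $$\mathcal B_k=\{x^k,x^{k-1},x^{k-1}y,\dots,x,xy,1,y,\dots,y^k\},\qquad \widetilde{\mathcal B}_k=\{x^ky,x^{k-1},x^{k-1}y,\dots,x,xy,1,y,\dots,y^k\},$$ and $V^{(k)}=\operatorname{Lin}\widetilde{\mathcal B}_k$. (Then $\mathcal B_k$ is a basis of $\mathbb R[C]_{\le k}$, and products of two elements of $V^{(k)}$ lie in $\mathbb R[C]_{\le 2k}$.) Let $L:\mathbb R[x,y]_{\le 2k}\to\mathbb R$ be a linear functional that vanishes on $I\cap\mathbb R[x,y]_{\le 2k}$, and let $L_C:\mathbb R[C]_{\le 2k}\to\mathbb R$, $L_C(f+I)=L(f)$.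 Let $\overline L$, $\overline L_C$ and $\overline L_{C,V^{(k)},1}$ be the bilinear forms $(f,g)\mapsto L(fg)$ on $\mathbb R[x,y]_{\le k}$, and $(f,g)\mapsto L_C(fg)$ on $\mathbb R[C]_{\le k}$ and on $V^{(k)}$, respectively. Assume that $L$ is $C$-singular, that is, $\ker\overline L\ne I\cap\mathbb R[x,y]_{\le k}$ or $\ker\overline L_{C,V^{(k)},1}\neq\{0\}$. For $n\ge 0$ let $\mathcal L(nD)=\{q/(t^2-d)^n: q\in\mathbb R[t],\ \deg q\le 3n\}\subset\mathbb R(t)$; this is the Riemann–Roch space of $nD$, where $D=Q_{\sqrt d}+Q_{-\sqrt d}+Q_\infty$ is the sum of the points $\sqrt d,-\sqrt d,\infty$ of $\mathbb P^1$. A *square positive extension* of $L$ is a linear functional $\widehat L:\mathcal L(2kD)\to\mathbb R$ with $\widehat L\big(p\big(\tfrac{-at+e}{t^2-d},t\big)\big)=L(p)$ for all $p\in\mathbb R[x,y]_{\le 2k}$ and $\widehat L(f^2)\ge 0$ for all $f\in\mathcal L(kD)$. It induces the univariate functional $\ell:\mathbb R[t]_{\le 6k}\to\mathbb R$, $\ell(f)=\widehat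 L\big(f/(t^2-d)^{2k}\big)$; a *generating polynomial* of $\ell$ is a nonzero polynomial of lowest degree in the kernel of the form $(f,g)\mapsto\ell(fg)$ on $\mathbb R[t]_{\le 3k}$ (it is unique up to a scalar factor, if it exists). Then the following are equivalent: 1. $L$ is a $C$-moment functional: there is a positive Borel measure $\mu$ supported on $C$ such that every $p\in\mathbb R[x,y]_{\le 2k}$ is $\mu$-integrable and $L(p)=\int_C p\,d\mu$. 2. $L_C$ is square positive ($L_C(f^2)\ge0$ for all $f\in\mathbb R[C]_{\le k}$) and $(V^{(k)},1)$-locally square positive ($L_C(g^2)\ge 0$ for all $g\in V^{(k)}$); there is a square positive extension $\widehat L$ of $L$ for which the generating polynomial of the induced functional $\ell$ exists and $\sqrt d$, $-\sqrt d$ are not zeros of it; and one of the following holds: (a) $\operatorname{rank}\overline L_C=\operatorname{rank}\big(\overline L_C|_U\big)$ for $U=\operatorname{Lin}(\mathcal B_k\setminus\{y^k\})$; (b) $\operatorname{rank}\overline L_{C,V^{(k)},1}=\operatorname{rank}\big(\overline L_{C,V^{(k)},1}|_W\big)$ for $W=\operatorname{Lin}(\widetilde{\mathcal B}_k\setminus\{y^k\})$.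 3. The same as 2, with "there is a square positive extension $\widehat L$ of $L$ for which" replaced by "for every square positive extension $\widehat L$ of $L$,". -/

import Mathlib

noncomputable section

namespace CubicTMP

/-! ### Bilinear forms -/

/-- The form `(f, g) ↦ L (f * g)` on a subspace `V` of an algebra, for a linear functional `L`
on a subspace `U` which contains all products of two elements of `V`. -/
def mulForm {A : Type*} [CommRing A] [Algebra ℝ A] (V U : Submodule ℝ A)
    (h : ∀ f ∈ V, ∀ g ∈ V, f * g ∈ U) (L : U →ₗ[ℝ] ℝ) : LinearMap.BilinForm ℝ V :=
  LinearMap.mk₂ ℝ (fun f g => L ⟨(f : A) * (g : A), h f f.2 g g.2⟩)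
    (fun f₁ f₂ g => by
      rw [← map_add]; congr 1; ext; simp [add_mul])
    (fun c f g => by
      rw [← map_smul]; congr 1; ext; simp)
    (fun f g₁ g₂ => by
      rw [← map_add]; congr 1; ext; simp [mul_add])
    (fun c f g => by
      rw [← map_smul]; congr 1; ext; simp)

/-- `B (v, v) ≥ 0` for all `v`. -/
def IsPos {V : Type*} [AddCommMonoid V] [Module ℝ V] (B : LinearMap.BilinForm ℝ V) : Prop :=
  ∀ v : V, 0 ≤ B v v

/-- The rank of a bilinear form (on a finite-dimensional space). -/
def formRank {V : Type*} [AddCommMonoid V] [Module ℝ V] (B : LinearMap.BilinForm ℝ V) : ℕ :=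
  Module.finrank ℝ (LinearMap.range B)

/-! ### Plane curves, their coordinate rings, and functionals on polynomials -/

/-- `ℝ[x,y]_{≤ m}`. -/
abbrev polyDeg (m : ℕ) : Submodule ℝ (MvPolynomial (Fin 2) ℝ) :=
  MvPolynomial.restrictTotalDegree (Fin 2) ℝ m

/-- `L` is a `K`-moment functional: it is integration against a (positive) Borel measure on the
plane which is carried by `K`. -/
def IsMomentFunctional (K : Set (Fin 2 → ℝ)) {m : ℕ} (L : polyDeg m →ₗ[ℝ] ℝ) : Prop :=
  ∃ μ : MeasureTheory.Measure (Fin 2 → ℝ), μ Kᶜ = 0 ∧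
    ∀ p : polyDeg m,
      MeasureTheory.Integrable (fun z => MvPolynomial.eval z (p : MvPolynomial (Fin 2) ℝ)) μ ∧
      L p = ∫ z, MvPolynomial.eval z (p : MvPolynomial (Fin 2) ℝ) ∂μ

/-- `ℝ[K] = ℝ[x,y] / I`, where `I` is the vanishing ideal of `K`. -/
abbrev CoordRing (K : Set (Fin 2 → ℝ)) : Type :=
  MvPolynomial (Fin 2) ℝ ⧸ MvPolynomial.vanishingIdeal ℝ K

/-- The restriction map `ℝ[x,y]_{≤ m} → ℝ[K]`. -/
def toCoord (K : Set (Fin 2 → ℝ)) (m : ℕ) : polyDeg m →ₗ[ℝ] CoordRing K :=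
  (Ideal.Quotient.mkₐ ℝ (MvPolynomial.vanishingIdeal ℝ K)).toLinearMap ∘ₗ (polyDeg m).subtype

/-- `ℝ[K]_{≤ m}`, the image of `ℝ[x,y]_{≤ m}`. -/
def coordDeg (K : Set (Fin 2 → ℝ)) (m : ℕ) : Submodule ℝ (CoordRing K) :=
  LinearMap.range (toCoord K m)

/-- `L` vanishes on `I_{≤ m} = I ∩ ℝ[x,y]_{≤ m}`; equivalently, `L_K` is well defined. -/
def VanishesOnIdeal (K : Set (Fin 2 → ℝ)) {m : ℕ} (L : polyDeg m →ₗ[ℝ] ℝ) : Prop :=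
  ∀ p : polyDeg m, (p : MvPolynomial (Fin 2) ℝ) ∈ MvPolynomial.vanishingIdeal ℝ K → L p = 0

theorem toCoord_eq_zero_iff (K : Set (Fin 2 → ℝ)) (m : ℕ) (p : polyDeg m) :
    toCoord K m p = 0 ↔
      (p : MvPolynomial (Fin 2) ℝ) ∈ MvPolynomial.vanishingIdeal ℝ K := by
  simp [toCoord, Ideal.Quotient.eq_zero_iff_mem]

theorem ker_toCoord_le (K : Set (Fin 2 → ℝ)) {m : ℕ} (L : polyDeg m →ₗ[ℝ] ℝ)
    (hL : VanishesOnIdeal K L) : LinearMap.ker (toCoord K m) ≤ LinearMap.ker L :=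
  fun p hp => LinearMap.mem_ker.2 (hL p ((toCoord_eq_zero_iff K m p).1 (LinearMap.mem_ker.1 hp)))

/-- The induced functional `L_K : ℝ[K]_{≤ m} → ℝ`, `L_K (f + I) = L f`. -/
def inducedFunctional (K : Set (Fin 2 → ℝ)) {m : ℕ} (L : polyDeg m →ₗ[ℝ] ℝ)
    (hL : VanishesOnIdeal K L) : coordDeg K m →ₗ[ℝ] ℝ :=
  ((LinearMap.ker (toCoord K m)).liftQ L (ker_toCoord_le K L hL)) ∘ₗ
    (toCoord K m).quotKerEquivRange.symm.toLinearMap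

theorem inducedFunctional_apply (K : Set (Fin 2 → ℝ)) {m : ℕ} (L : polyDeg m →ₗ[ℝ] ℝ)
    (hL : VanishesOnIdeal K L) (p : polyDeg m) :
    inducedFunctional K L hL ⟨toCoord K m p, LinearMap.mem_range_self _ p⟩ = L p := by
  have h : (toCoord K m).quotKerEquivRange.symm
      ⟨toCoord K m p, LinearMap.mem_range_self _ p⟩ =
      (LinearMap.ker (toCoord K m)).mkQ p :=
    (toCoord K m).quotKerEquivRange_symm_apply_image p (LinearMap.mem_range_self _ p)
  change (LinearMap.ker (toCoord K m)).liftQ L (ker_toCoord_le K L hL)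
    ((toCoord K m).quotKerEquivRange.symm ⟨toCoord K m p, LinearMap.mem_range_self _ p⟩) = L p
  exact (congrArg _ h).trans (Submodule.liftQ_apply _ _ _)

theorem mk_mem_coordDeg (K : Set (Fin 2 → ℝ)) {m : ℕ} (p : MvPolynomial (Fin 2) ℝ)
    (hp : p.totalDegree ≤ m) :
    Ideal.Quotient.mk (MvPolynomial.vanishingIdeal ℝ K) p ∈ coordDeg K m :=
  ⟨⟨p, (MvPolynomial.mem_restrictTotalDegree _ _ _).2 hp⟩, rfl⟩

theorem mem_coordDeg (K : Set (Fin 2 → ℝ)) {m : ℕ} {f : CoordRing K} (hf : f ∈ coordDeg K m) :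
    ∃ p : MvPolynomial (Fin 2) ℝ, p.totalDegree ≤ m ∧
      Ideal.Quotient.mk (MvPolynomial.vanishingIdeal ℝ K) p = f := by
  obtain ⟨p, rfl⟩ := hf
  exact ⟨p, (MvPolynomial.mem_restrictTotalDegree _ _ _).1 p.2, rfl⟩

theorem polyDeg_mul (k : ℕ) : ∀ f ∈ polyDeg k, ∀ g ∈ polyDeg k, f * g ∈ polyDeg (2 * k) := by
  intro f hf g hg
  rw [MvPolynomial.mem_restrictTotalDegree] at *
  exact (MvPolynomial.totalDegree_mul f g).trans (by omega)

theorem coordDeg_mul_mem (K : Set (Fin 2 → ℝ)) {m n : ℕ} {f g : CoordRing K}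
    (hf : f ∈ coordDeg K m) (hg : g ∈ coordDeg K n) : f * g ∈ coordDeg K (m + n) := by
  obtain ⟨p, hp, rfl⟩ := mem_coordDeg K hf
  obtain ⟨q, hq, rfl⟩ := mem_coordDeg K hg
  rw [← map_mul]
  exact mk_mem_coordDeg K _ ((MvPolynomial.totalDegree_mul p q).trans (by omega))

theorem coordDeg_mono (K : Set (Fin 2 → ℝ)) {m n : ℕ} (h : m ≤ n) :
    coordDeg K m ≤ coordDeg K n := by
  intro f hf
  obtain ⟨p, hp, rfl⟩ := mem_coordDeg K hf
  exact mk_mem_coordDeg K _ (hp.trans h)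

theorem coordDeg_mul (K : Set (Fin 2 → ℝ)) (k : ℕ) :
    ∀ f ∈ coordDeg K k, ∀ g ∈ coordDeg K k, f * g ∈ coordDeg K (2 * k) := by
  intro f hf g hg
  rw [two_mul]
  exact coordDeg_mul_mem K hf hg

/-- The form `(f, g) ↦ L (f g)` on `ℝ[x,y]_{≤ k}`. -/
def polyForm {k : ℕ} (L : polyDeg (2 * k) →ₗ[ℝ] ℝ) : LinearMap.BilinForm ℝ (polyDeg k) :=
  mulForm (polyDeg k) (polyDeg (2 * k)) (polyDeg_mul k) L

/-- The form `(f, g) ↦ L_K (f g)` on `ℝ[K]_{≤ k}`. -/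
def coordForm (K : Set (Fin 2 → ℝ)) {k : ℕ} (L : polyDeg (2 * k) →ₗ[ℝ] ℝ)
    (hL : VanishesOnIdeal K L) : LinearMap.BilinForm ℝ (coordDeg K k) :=
  mulForm (coordDeg K k) (coordDeg K (2 * k)) (coordDeg_mul K k) (inducedFunctional K L hL)

/-! ### The cubic `x y² + a y - d x - e = 0` -/

/-- `x y² + a y - d x - e`. -/
def cubic (a d e : ℝ) : MvPolynomial (Fin 2) ℝ :=
  MvPolynomial.X 0 * MvPolynomial.X 1 ^ 2 + MvPolynomial.C a * MvPolynomial.X 1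
    - MvPolynomial.C d * MvPolynomial.X 0 - MvPolynomial.C e

/-- The real zero set of the cubic. -/
def curve (a d e : ℝ) : Set (Fin 2 → ℝ) := {z | MvPolynomial.eval z (cubic a d e) = 0}

/-- The coordinate function `x` on the curve. -/
def cx (a d e : ℝ) : CoordRing (curve a d e) := Ideal.Quotient.mk _ (MvPolynomial.X 0)

/-- The coordinate function `y` on the curve. -/
def cy (a d e : ℝ) : CoordRing (curve a d e) := Ideal.Quotient.mk _ (MvPolynomial.X 1)

/-- `{x^k, x^(k-1), x^(k-1) y, …, x, x y, 1, y, …, y^k}`, a basis of `ℝ[C]_{≤ k}`. -/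
def basisB (a d e : ℝ) (k : ℕ) : Set (CoordRing (curve a d e)) :=
  {cx a d e ^ k} ∪
    {f | ∃ j, 1 ≤ j ∧ j < k ∧ (f = cx a d e ^ j ∨ f = cx a d e ^ j * cy a d e)} ∪
    {f | ∃ l, l ≤ k ∧ f = cy a d e ^ l}

/-- `{x^k y, x^(k-1), x^(k-1) y, …, x, x y, 1, y, …, y^k}`. -/
def basisBt (a d e : ℝ) (k : ℕ) : Set (CoordRing (curve a d e)) :=
  {cx a d e ^ k * cy a d e} ∪
    {f | ∃ j, 1 ≤ j ∧ j < k ∧ (f = cx a d e ^ j ∨ f = cx a d e ^ j * cy a d e)} ∪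
    {f | ∃ l, l ≤ k ∧ f = cy a d e ^ l}

/-- `V^(k)`, the span of `x^k y, x^(k-1), x^(k-1) y, …, x, x y, 1, y, …, y^k`. -/
def spaceV (a d e : ℝ) (k : ℕ) : Submodule ℝ (CoordRing (curve a d e)) :=
  Submodule.span ℝ (basisBt a d e k)

theorem cx_mul_cy_sq (a d e : ℝ) :
    cx a d e * cy a d e ^ 2 = Ideal.Quotient.mk _
      (MvPolynomial.C d * MvPolynomial.X 0 + MvPolynomial.C e
        - MvPolynomial.C a * MvPolynomial.X 1) := by
  unfold cx cy
  rw [← map_pow, ← map_mul, Ideal.Quotient.eq, MvPolynomial.mem_vanishingIdeal_iff]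
  intro z hz
  have h : MvPolynomial.eval z (cubic a d e) = 0 := hz
  simp only [cubic, map_sub, map_add, map_mul, map_pow, MvPolynomial.eval_X,
    MvPolynomial.eval_C] at h
  simp only [map_sub, map_add, map_mul, map_pow, MvPolynomial.aeval_X,
    MvPolynomial.aeval_C, Algebra.algebraMap_self, RingHom.id_apply]
  linarith

theorem monomial_mem (a d e : ℝ) {i j m : ℕ} (h : i + j ≤ m) :
    cx a d e ^ i * cy a d e ^ j ∈ coordDeg (curve a d e) m := by
  unfold cx cy
  rw [← map_pow, ← map_pow, ← map_mul]
  refine mk_mem_coordDeg _ _ ((MvPolynomial.totalDegree_mul _ _).trans ?_)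
  rw [MvPolynomial.totalDegree_X_pow, MvPolynomial.totalDegree_X_pow]
  exact h

theorem monomial_mem' (a d e : ℝ) {i j m : ℕ} (h : i + j + 1 ≤ m) :
    cx a d e ^ (i + 1) * cy a d e ^ (j + 2) ∈ coordDeg (curve a d e) m := by
  have h1 : cx a d e ^ (i + 1) * cy a d e ^ (j + 2) =
      (cx a d e ^ i * cy a d e ^ j) * (cx a d e * cy a d e ^ 2) := by ring
  rw [h1, cx_mul_cy_sq]
  refine coordDeg_mono _ h (coordDeg_mul_mem _ (monomial_mem a d e le_rfl) ?_)
  apply mk_mem_coordDeg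
  have hX : ∀ (c : ℝ) (i : Fin 2),
      (MvPolynomial.C c * MvPolynomial.X i : MvPolynomial (Fin 2) ℝ).totalDegree ≤ 1 := by
    intro c i
    refine (MvPolynomial.totalDegree_mul _ _).trans ?_
    simp
  refine (MvPolynomial.totalDegree_sub _ _).trans (max_le ?_ (hX _ _))
  refine (MvPolynomial.totalDegree_add _ _).trans (max_le (hX _ _) ?_)
  simp

/-- A generator of `V^(k)` is the top one or lies in `ℝ[C]_{≤ k}`. -/
theorem basisBt_cases (a d e : ℝ) (k : ℕ) {f : CoordRing (curve a d e)}
    (hf : f ∈ basisBt a d e k) :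
    ∃ i j, f = cx a d e ^ i * cy a d e ^ j ∧
      ((i = k ∧ j = 1) ∨ (i < k ∧ j ≤ 1 ∧ i + j ≤ k) ∨ (i = 0 ∧ j ≤ k)) := by
  rcases hf with (hf | ⟨j, h1, h2, hf | hf⟩) | ⟨l, h1, hf⟩
  · exact ⟨k, 1, by simpa using hf, by omega⟩
  · exact ⟨j, 0, by simpa using hf, by omega⟩
  · exact ⟨j, 1, by simpa using hf, by omega⟩
  · exact ⟨0, l, by simpa using hf, by omega⟩

theorem spaceV_mul (a d e : ℝ) {k : ℕ} (hk : 1 ≤ k) :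
    ∀ f ∈ spaceV a d e k, ∀ g ∈ spaceV a d e k, f * g ∈ coordDeg (curve a d e) (2 * k) := by
  intro f hf g hg
  have key : spaceV a d e k * spaceV a d e k ≤ coordDeg (curve a d e) (2 * k) := by
    unfold spaceV
    rw [Submodule.span_mul_span, Submodule.span_le]
    rintro _ ⟨f, hf, g, hg, rfl⟩
    obtain ⟨i, j, rfl, h1⟩ := basisBt_cases a d e k hf
    obtain ⟨i', j', rfl, h2⟩ := basisBt_cases a d e k hg
    have h3 : (cx a d e ^ i * cy a d e ^ j) * (cx a d e ^ i' * cy a d e ^ j') =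
        cx a d e ^ (i + i') * cy a d e ^ (j + j') := by ring
    change (cx a d e ^ i * cy a d e ^ j) * (cx a d e ^ i' * cy a d e ^ j') ∈ _
    rw [h3]
    by_cases h4 : 1 ≤ i + i' ∧ 2 ≤ j + j'
    · obtain ⟨u, hu⟩ := Nat.exists_eq_add_of_le' h4.1
      obtain ⟨v, hv⟩ := Nat.exists_eq_add_of_le' h4.2
      rw [hu, hv]
      exact monomial_mem' a d e (by omega)
    · exact monomial_mem a d e (by omega)
  exact key (Submodule.mul_mem_mul hf hg)

/-- The local form `(g, h) ↦ L_C (1 · g h)` on `V^(k)`. -/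
def localForm (a d e : ℝ) {k : ℕ} (hk : 1 ≤ k) (L : polyDeg (2 * k) →ₗ[ℝ] ℝ)
    (hL : VanishesOnIdeal (curve a d e) L) : LinearMap.BilinForm ℝ (spaceV a d e k) :=
  mulForm (spaceV a d e k) (coordDeg (curve a d e) (2 * k)) (spaceV_mul a d e hk)
    (inducedFunctional (curve a d e) L hL)

/-- `L` is nonsingular for the curve: the kernel of `(f, g) ↦ L (f g)` on `ℝ[x,y]_{≤ k}` is
`I_{≤ k}`, and the local form on `V^(k)` has trivial kernel. -/
def IsNonsingular (a d e : ℝ) {k : ℕ} (hk : 1 ≤ k) (L : polyDeg (2 * k) →ₗ[ℝ] ℝ)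
    (hL : VanishesOnIdeal (curve a d e) L) : Prop :=
  (∀ f : polyDeg k, f ∈ LinearMap.ker (polyForm L) ↔
    (f : MvPolynomial (Fin 2) ℝ) ∈ MvPolynomial.vanishingIdeal ℝ (curve a d e)) ∧
  LinearMap.ker (localForm a d e hk L hL) = ⊥

/-! ### Rational functions on the line -/

/-- The polynomial `t² - d`. -/
def h2 (d : ℝ) : Polynomial ℝ := Polynomial.X ^ 2 - Polynomial.C d

theorem h2_monic (d : ℝ) : (h2 d).Monic := by
  unfold h2; monicity!

theorem h2_natDegree (d : ℝ) : (h2 d).natDegree = 2 := by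
  unfold h2; compute_degree!

theorem h2_ne_zero (d : ℝ) : h2 d ≠ 0 := (h2_monic d).ne_zero

theorem h2_intDegree_pow (d : ℝ) (n : ℕ) :
    (algebraMap (Polynomial ℝ) (RatFunc ℝ) (h2 d ^ n)).intDegree = 2 * n := by
  rw [RatFunc.intDegree_polynomial, Polynomial.natDegree_pow, h2_natDegree]
  push_cast; ring

/-- Membership in the space below: `f = q / (t² - d)^n` with `deg q ≤ 3 n`. -/
theorem rr_mem_iff (d : ℝ) (n : ℕ) (f : RatFunc ℝ) :
    (f.denom ∣ h2 d ^ n ∧ f.intDegree ≤ n) ↔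
      ∃ q : Polynomial ℝ, q.natDegree ≤ 3 * n ∧
        f = algebraMap _ _ q / algebraMap _ _ (h2 d ^ n) := by
  have hne : algebraMap (Polynomial ℝ) (RatFunc ℝ) (h2 d ^ n) ≠ 0 :=
    RatFunc.algebraMap_ne_zero (pow_ne_zero _ (h2_ne_zero d))
  rw [RatFunc.denom_dvd (pow_ne_zero _ (h2_ne_zero d))]
  have hdeg : ∀ q : Polynomial ℝ,
      (algebraMap (Polynomial ℝ) (RatFunc ℝ) q / algebraMap _ _ (h2 d ^ n)).intDegree ≤ n ↔
        q.natDegree ≤ 3 * n := by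
    intro q
    by_cases hq : q = 0
    · subst hq; simp
    · rw [RatFunc.intDegree_div (RatFunc.algebraMap_ne_zero hq) hne, h2_intDegree_pow,
        RatFunc.intDegree_polynomial]
      omega
  constructor
  · rintro ⟨⟨q, rfl⟩, h⟩
    exact ⟨q, (hdeg q).1 h, rfl⟩
  · rintro ⟨q, hq, rfl⟩
    exact ⟨⟨q, rfl⟩, (hdeg q).2 hq⟩

/-- The Riemann–Roch space `𝓛(n D)` on the projective line for the divisor
`D = Q_{√d} + Q_{-√d} + Q_∞`, `d > 0`: the rational functions whose only finite poles are `√d` and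
`-√d`, each of order at most `n`, and whose order of pole at infinity is at most `n`. -/
def rrSpace (d : ℝ) (n : ℕ) : Submodule ℝ (RatFunc ℝ) where
  carrier := {f | f.denom ∣ h2 d ^ n ∧ f.intDegree ≤ n}
  zero_mem' := by simp
  add_mem' := by
    intro f g hf hg
    obtain ⟨p, hp, rfl⟩ := (rr_mem_iff d n f).1 hf
    obtain ⟨q, hq, rfl⟩ := (rr_mem_iff d n g).1 hg
    refine (rr_mem_iff d n _).2 ⟨p + q, (Polynomial.natDegree_add_le _ _).trans (max_le hp hq), ?_⟩
    rw [map_add, add_div]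
  smul_mem' := by
    intro c f hf
    obtain ⟨p, hp, rfl⟩ := (rr_mem_iff d n f).1 hf
    refine (rr_mem_iff d n _).2 ⟨c • p, (Polynomial.natDegree_smul_le _ _).trans hp, ?_⟩
    rw [← smul_div_assoc, RatFunc.smul_eq_C_smul, Polynomial.smul_eq_C_mul, map_mul]
    simp [RatFunc.algebraMap_C, Algebra.smul_def]

theorem mem_rrSpace (d : ℝ) (n : ℕ) (f : RatFunc ℝ) :
    f ∈ rrSpace d n ↔ ∃ q : Polynomial ℝ, q.natDegree ≤ 3 * n ∧
        f = algebraMap _ _ q / algebraMap _ _ (h2 d ^ n) := rr_mem_iff d n f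

theorem rrSpace_mul_mem (d : ℝ) {m n : ℕ} {f g : RatFunc ℝ}
    (hf : f ∈ rrSpace d m) (hg : g ∈ rrSpace d n) : f * g ∈ rrSpace d (m + n) := by
  obtain ⟨p, hp, rfl⟩ := (mem_rrSpace d m f).1 hf
  obtain ⟨q, hq, rfl⟩ := (mem_rrSpace d n g).1 hg
  refine (mem_rrSpace d _ _).2 ⟨p * q, Polynomial.natDegree_mul_le.trans (by omega), ?_⟩
  rw [div_mul_div_comm, ← map_mul, ← map_mul, pow_add]

theorem rrSpace_mul (d : ℝ) (k : ℕ) :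
    ∀ f ∈ rrSpace d k, ∀ g ∈ rrSpace d k, f * g ∈ rrSpace d (2 * k) := by
  intro f hf g hg
  rw [two_mul]
  exact rrSpace_mul_mem d hf hg

theorem rrSpace_mono (d : ℝ) {m n : ℕ} (h : m ≤ n) : rrSpace d m ≤ rrSpace d n := by
  intro f hf
  exact ⟨hf.1.trans (pow_dvd_pow _ h), hf.2.trans (by exact_mod_cast h)⟩

/-- The form `(f, g) ↦ L̂ (f g)` on `𝓛(k D)`, for a functional `L̂` on `𝓛(2k D)`. -/
def rrForm (d : ℝ) {k : ℕ} (Lhat : rrSpace d (2 * k) →ₗ[ℝ] ℝ) :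
    LinearMap.BilinForm ℝ (rrSpace d k) :=
  mulForm (rrSpace d k) (rrSpace d (2 * k)) (rrSpace_mul d k) Lhat

/-- `h₃ = (- a t + e) / (t² - d)`. -/
def h3 (a d e : ℝ) : RatFunc ℝ :=
  algebraMap (Polynomial ℝ) (RatFunc ℝ) (-(Polynomial.C a * Polynomial.X) + Polynomial.C e) /
    algebraMap (Polynomial ℝ) (RatFunc ℝ) (h2 d)

/-- Pullback along the parametrization `t ↦ (h₃(t), t)` of the curve: `p(x, y) ↦ p(h₃(t), t)`. -/
def pullback (a d e : ℝ) : MvPolynomial (Fin 2) ℝ →ₐ[ℝ] RatFunc ℝ :=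
  MvPolynomial.aeval ![h3 a d e, RatFunc.X]

theorem h3_mem (a d e : ℝ) : h3 a d e ∈ rrSpace d 1 := by
  refine (mem_rrSpace d 1 _).2 ⟨-(Polynomial.C a * Polynomial.X) + Polynomial.C e, ?_, ?_⟩
  · refine le_trans ?_ (show 1 ≤ 3 * 1 by norm_num)
    compute_degree
  · rw [pow_one]; rfl

theorem X_mem (d : ℝ) : (RatFunc.X : RatFunc ℝ) ∈ rrSpace d 1 := by
  refine ⟨?_, ?_⟩ <;> simp

theorem one_mem (d : ℝ) : (1 : RatFunc ℝ) ∈ rrSpace d 0 := by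
  refine ⟨?_, ?_⟩ <;> simp

theorem rrSpace_pow_mem (d : ℝ) {f : RatFunc ℝ} (hf : f ∈ rrSpace d 1) (n : ℕ) :
    f ^ n ∈ rrSpace d n := by
  induction n with
  | zero => simpa using one_mem d
  | succ n ih => rw [pow_succ]; exact rrSpace_mul_mem d ih hf

theorem pullback_mem (a d e : ℝ) {m : ℕ} (p : polyDeg m) :
    pullback a d e (p : MvPolynomial (Fin 2) ℝ) ∈ rrSpace d m := by
  have hp := (MvPolynomial.mem_restrictTotalDegree _ _ _).1 p.2
  rw [pullback, MvPolynomial.aeval_def, MvPolynomial.eval₂_eq']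
  refine Submodule.sum_mem _ (fun s hs => ?_)
  rw [← Algebra.smul_def]
  refine Submodule.smul_mem _ _ ?_
  rw [Fin.prod_univ_two]
  have hs' : s 0 + s 1 ≤ m := by
    have := (MvPolynomial.le_totalDegree hs).trans hp
    rwa [Finsupp.sum_fintype _ _ (fun _ => rfl), Fin.sum_univ_two] at this
  exact rrSpace_mono d hs' (rrSpace_mul_mem d (rrSpace_pow_mem d (h3_mem a d e) _)
    (rrSpace_pow_mem d (X_mem d) _))

/-- `L̂` on `𝓛(2k D)` extends (the transport to rational functions in `t` of) `L`. -/
def IsExtension (a d e : ℝ) {k : ℕ} (L : polyDeg (2 * k) →ₗ[ℝ] ℝ)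
    (Lhat : rrSpace d (2 * k) →ₗ[ℝ] ℝ) : Prop :=
  ∀ p : polyDeg (2 * k), Lhat ⟨pullback a d e p, pullback_mem a d e p⟩ = L p

/-- `ℝ[t]_{≤ m}`. -/
abbrev uniDeg (m : ℕ) : Submodule ℝ (Polynomial ℝ) := Polynomial.degreeLE ℝ m

theorem uniDeg_mul (k : ℕ) :
    ∀ f ∈ uniDeg (3 * k), ∀ g ∈ uniDeg (3 * k), f * g ∈ uniDeg (6 * k) := by
  intro f hf g hg
  rw [Polynomial.mem_degreeLE, ← Polynomial.natDegree_le_iff_degree_le] at *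
  exact Polynomial.natDegree_mul_le.trans (by omega)

/-- `f ↦ f / (t² - d)^(2k)` from `ℝ[t]_{≤ 6k}` to `𝓛(2k D)`. -/
def divMap (d : ℝ) (k : ℕ) : uniDeg (6 * k) →ₗ[ℝ] rrSpace d (2 * k) where
  toFun f := ⟨algebraMap _ _ (f : Polynomial ℝ) / algebraMap _ _ (h2 d ^ (2 * k)),
    (mem_rrSpace d _ _).2 ⟨f, by
      have := Polynomial.natDegree_le_iff_degree_le.2 (Polynomial.mem_degreeLE.1 f.2)
      omega, rfl⟩⟩
  map_add' f g := by
    ext; simp [add_div]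
  map_smul' c f := by
    ext
    simp only [Submodule.coe_smul, RingHom.id_apply]
    rw [← smul_div_assoc]
    congr 1
    rw [Polynomial.smul_eq_C_mul, map_mul]
    simp [RatFunc.algebraMap_C, Algebra.smul_def]

/-- The induced functional on `ℝ[t]_{≤ 6k}`, `f ↦ L̂ (f / (t² - d)^(2k))`. -/
def uniFunctional (d : ℝ) {k : ℕ} (Lhat : rrSpace d (2 * k) →ₗ[ℝ] ℝ) :
    uniDeg (6 * k) →ₗ[ℝ] ℝ :=
  Lhat ∘ₗ divMap d k

/-- The form `(f, g) ↦ ℓ (f g)` on `ℝ[t]_{≤ 3k}`. -/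
def uniForm {k : ℕ} (l : uniDeg (6 * k) →ₗ[ℝ] ℝ) : LinearMap.BilinForm ℝ (uniDeg (3 * k)) :=
  mulForm (uniDeg (3 * k)) (uniDeg (6 * k)) (uniDeg_mul k) l

/-- `p` is a generating polynomial of `ℓ`: a nonzero polynomial of lowest degree in the kernel of
the form `(f, g) ↦ ℓ (f g)` on `ℝ[t]_{≤ 3k}`. -/
def IsGenerating {k : ℕ} (l : uniDeg (6 * k) →ₗ[ℝ] ℝ) (p : uniDeg (3 * k)) : Prop :=
  p ∈ LinearMap.ker (uniForm l) ∧ p ≠ 0 ∧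
    ∀ q ∈ LinearMap.ker (uniForm l), q ≠ 0 →
      (p : Polynomial ℝ).natDegree ≤ (q : Polynomial ℝ).natDegree

/-- The generating polynomial of `ℓ` (unique up to a scalar) exists and does not vanish at
`√d` and `-√d`. -/
def GeneratingNonvanishing (d : ℝ) {k : ℕ} (l : uniDeg (6 * k) →ₗ[ℝ] ℝ) : Prop :=
  ∃ p : uniDeg (3 * k), IsGenerating l p ∧
    (p : Polynomial ℝ).eval (Real.sqrt d) ≠ 0 ∧ (p : Polynomial ℝ).eval (-Real.sqrt d) ≠ 0

/-- One of the two rank equalities holds: deleting `y^k` from the basis of `ℝ[C]_{≤ k}`, or from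
the basis of `V^(k)`, does not change the rank of the corresponding form. -/
def RankCondition (a d e : ℝ) {k : ℕ} (hk : 1 ≤ k) (L : polyDeg (2 * k) →ₗ[ℝ] ℝ)
    (hL : VanishesOnIdeal (curve a d e) L) : Prop :=
  formRank (coordForm (curve a d e) L hL) =
      formRank ((coordForm (curve a d e) L hL).restrict
        ((Submodule.span ℝ (basisB a d e k \ {cy a d e ^ k})).submoduleOf
          (coordDeg (curve a d e) k))) ∨
    formRank (localForm a d e hk L hL) =
      formRank ((localForm a d e hk L hL).restrict
        ((Submodule.span ℝ (basisBt a d e k \ {cy a d e ^ k})).submoduleOf (spaceV a d e k)))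

end CubicTMP

end

noncomputable section

namespace CubicTMP

open Polynomial MeasureTheory

/-! ### Functionals on univariate polynomials that are nonnegative on squares -/

/-! Put δ = √d. Irreducibility forces the numerator `num` = e - a t to be nonzero at ±δ, so the
curve has no point with y² = d and t ↦ (`num`(t)/(t² - d), t) parametrizes it bijectively by t ≠ ±δ.
Everything is translated into numerators over a power of t² - d. Let u, v be the k-th powers of the
values of `num` at δ and -δ. Then ℝ[C]_{≤ k} corresponds to A, the polynomials q of degree at most
3k with (q(δ), q(-δ)) proportional to (u, v); V^(k) corresponds to B, the same with (u, -v); and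
ℝ[C]_{≤ 2k} corresponds to a hyperplane H of ℝ[t]_{≤ 6k}, given by (u², v²). Products within A or
within B land in H, so L determines a functional on H, and a square positive extension is an
extension from H to ℝ[t]_{≤ 6k} that is nonnegative on squares from ℝ[t]_{≤ 3k} = A + B. The
numerator of y^k has degree 3k and all other generators have smaller degree, so each rank equality
says that the form on A (or B) has a kernel element of exact degree 3k.

Extensions exist as soon as the forms on A and B are positive: only one entry of the Gram matrix is
free, and after orthogonalizing against A ∩ B it may be set to zero
(`exists_square_positive_completion`).

From 2 to 1: a singular positive functional with generating polynomial p has a Gauss quadrature at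
the roots of p, which are real and simple, plus a nonnegative multiple of the leading coefficient,
that is, an atom at infinity (`IsMinimalKernel.exists_quadrature`). An isotropic polynomial of exact
degree 3k removes the atom at infinity, and p(±δ) ≠ 0 keeps the atoms on the affine curve.

From 1 to 3: singularity yields a nonzero q in A or B with L(q²) = 0, so the measure sits on the
finitely many zeros of q. Every square positive extension must then equal this atomic functional,
not only on H (`eq_atomic_of_eq_on_nodeSpace`). Its generating polynomial is therefore the nodal
polynomial of the atoms, nonzero at ±δ, and a polynomial of exact degree 3k in A or B vanishing at
the atoms gives the rank condition (`exists_coeff_ne_zero_of_vanishing`). -/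

theorem finiteDimensional_of_natDegree_le {n : ℕ} {W : Submodule ℝ ℝ[X]}
    (h : ∀ q ∈ W, q.natDegree ≤ n) : FiniteDimensional ℝ W := by
  have h1 : W ≤ Polynomial.degreeLE ℝ n := fun q hq =>
    Polynomial.mem_degreeLE.2 (Polynomial.natDegree_le_iff_degree_le.1 (h q hq))
  have h2 : FiniteDimensional ℝ (Polynomial.degreeLE ℝ n) := by
    rw [Polynomial.degreeLE_eq_span_X_pow]
    infer_instance
  exact Submodule.finiteDimensional_of_le h1

theorem eq_zero_of_quadratic_nonneg {x y : ℝ} (hy : 0 ≤ y)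
    (h : ∀ c : ℝ, 0 ≤ 2 * c * x + c ^ 2 * y) : x = 0 := by
  by_contra hne
  have h2 : 0 < y + 1 := by linarith
  -- The minimizer would be c = -x / y; the shift by 1 also covers y = 0.
  have h1 := h (-x / (y + 1))
  have h3 : 2 * (-x / (y + 1)) * x + (-x / (y + 1)) ^ 2 * y =
      -(x ^ 2 * (y + 2) / (y + 1) ^ 2) := by
    field_simp
    ring
  rw [h3] at h1
  have : 0 < x ^ 2 * (y + 2) / (y + 1) ^ 2 := by positivity
  linarith

theorem map_sq_add_smul (l : ℝ[X] →ₗ[ℝ] ℝ) (f g : ℝ[X]) (c : ℝ) :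
    l ((f + c • g) * (f + c • g)) = l (f * f) + 2 * c * l (f * g) + c ^ 2 * l (g * g) := by
  have : (f + c • g) * (f + c • g) = f * f + (2 * c) • (f * g) + (c ^ 2) • (g * g) := by
    simp only [Polynomial.smul_eq_C_mul, map_mul, map_pow, map_ofNat]
    ring
  rw [this]
  simp

/-- Degenerate case of the Cauchy–Schwarz inequality. -/
theorem apply_mul_eq_zero_of_sq {W : Submodule ℝ ℝ[X]} {l : ℝ[X] →ₗ[ℝ] ℝ}
    (hpos : ∀ q ∈ W, 0 ≤ l (q * q)) {q r : ℝ[X]} (hq : q ∈ W) (hr : r ∈ W)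
    (h0 : l (q * q) = 0) : l (q * r) = 0 :=
  eq_zero_of_quadratic_nonneg (hpos r hr) fun c => by
    have := hpos _ (W.add_mem hq (W.smul_mem c hr))
    rw [map_sq_add_smul, h0] at this
    linarith

theorem apply_mul_eq_zero_of_natDegree_le {l : ℝ[X] →ₗ[ℝ] ℝ} {n : ℕ}
    (hpos : ∀ q : ℝ[X], q.natDegree ≤ n → 0 ≤ l (q * q)) {q r : ℝ[X]} (hq : q.natDegree ≤ n)
    (hr : r.natDegree ≤ n) (h0 : l (q * q) = 0) : l (q * r) = 0 := by
  have hW : ∀ q : ℝ[X], q ∈ Polynomial.degreeLE ℝ n ↔ q.natDegree ≤ n := fun q => by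
    rw [Polynomial.mem_degreeLE, Polynomial.natDegree_le_iff_degree_le]
  exact apply_mul_eq_zero_of_sq (W := Polynomial.degreeLE ℝ n)
    (fun q hq => hpos q ((hW q).1 hq)) ((hW q).2 hq) ((hW r).2 hr) h0

/-- Orthogonal projection with respect to a positive semidefinite form. -/
theorem exists_orthogonal_projection {l : ℝ[X] →ₗ[ℝ] ℝ} {V W : Submodule ℝ ℝ[X]}
    [FiniteDimensional ℝ W] (hWV : W ≤ V) (hpos : ∀ q ∈ V, 0 ≤ l (q * q)) {g : ℝ[X]}
    (hg : g ∈ V) : ∃ w ∈ W, ∀ w' ∈ W, l ((g - w) * w') = 0 := by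
  let T : W →ₗ[ℝ] Module.Dual ℝ W := ((LinearMap.mul ℝ ℝ[X]).compr₂ l).domRestrict₁₂ W W
  let F : Module.Dual ℝ W := (((LinearMap.mul ℝ ℝ[X]).compr₂ l) g).domRestrict W
  have hT : ∀ u v : W, T u v = l (u * v) := fun _ _ => rfl
  have hF : ∀ v : W, F v = l (g * v) := fun _ => rfl
  -- An element of the radical of the form on W is isotropic, hence orthogonal to g by
  -- Cauchy–Schwarz in V. In finite dimension a functional that kills the radical is represented by
  -- the form.
  have h1 : F ∈ (LinearMap.ker T).dualAnnihilator := by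
    rw [Submodule.mem_dualAnnihilator]
    intro w hw
    have h2 : l ((w : ℝ[X]) * w) = 0 := by
      rw [← hT, LinearMap.mem_ker.1 hw]; rfl
    rw [hF, mul_comm]
    exact apply_mul_eq_zero_of_sq hpos (hWV w.2) hg h2
  rw [← LinearMap.range_dualMap_eq_dualAnnihilator_ker] at h1
  obtain ⟨ξ, hξ⟩ := h1
  obtain ⟨w, rfl⟩ := (Module.evalEquiv ℝ W).surjective ξ
  refine ⟨w, w.2, fun w' hw' => ?_⟩
  have h3 : F ⟨w', hw'⟩ = T ⟨w', hw'⟩ w := by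
    rw [← hξ]; rfl
  rw [hF, hT] at h3
  rw [sub_mul, map_sub, h3, mul_comm, sub_self]

/-- The polynomial of degree at most one with value `x` at `δ` and `y` at `-δ`. -/
def lineThrough (δ x y : ℝ) : ℝ[X] := C ((x + y) / 2) + C ((x - y) / (2 * δ)) * X

theorem eval_lineThrough {δ : ℝ} (hδ : δ ≠ 0) (x y : ℝ) : (lineThrough δ x y).eval δ = x := by
  simp only [lineThrough, eval_add, eval_mul, eval_C, eval_X]
  field_simp
  ring

theorem eval_lineThrough_neg {δ : ℝ} (hδ : δ ≠ 0) (x y : ℝ) :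
    (lineThrough δ x y).eval (-δ) = y := by
  simp only [lineThrough, eval_add, eval_mul, eval_C, eval_X]
  field_simp
  ring

theorem natDegree_lineThrough_le (δ x y : ℝ) : (lineThrough δ x y).natDegree ≤ 1 := by
  unfold lineThrough
  compute_degree

/-- The polynomials of degree at most `n` with `(q(δ), q(-δ))` proportional to `(u, v)`. -/
def nodeSpace (δ u v : ℝ) (n : ℕ) : Submodule ℝ ℝ[X] where
  carrier := {q | q.natDegree ≤ n ∧ q.eval δ * v = q.eval (-δ) * u}
  zero_mem' := by simp
  add_mem' := by
    rintro p q ⟨hp, hp'⟩ ⟨hq, hq'⟩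
    refine ⟨(natDegree_add_le _ _).trans (max_le hp hq), ?_⟩
    rw [eval_add, eval_add, add_mul, add_mul, hp', hq']
  smul_mem' := by
    rintro c p ⟨hp, hp'⟩
    refine ⟨(natDegree_smul_le _ _).trans hp, ?_⟩
    rw [eval_smul, eval_smul, smul_eq_mul, smul_eq_mul, mul_assoc, mul_assoc, hp']

theorem nodeSpace_mul {δ u v u' v' : ℝ} {m n : ℕ} {p q : ℝ[X]} (hp : p ∈ nodeSpace δ u v m)
    (hq : q ∈ nodeSpace δ u' v' n) : p * q ∈ nodeSpace δ (u * u') (v * v') (m + n) := by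
  refine ⟨natDegree_mul_le.trans (add_le_add hp.1 hq.1), ?_⟩
  rw [eval_mul, eval_mul]
  calc _ = (p.eval δ * v) * (q.eval δ * v') := by ring
    _ = _ := by rw [hp.2, hq.2]; ring

theorem mul_mem_nodeSpace_sq {δ u v : ℝ} {n : ℕ} {p q : ℝ[X]} (hp : p ∈ nodeSpace δ u v n)
    (hq : q ∈ nodeSpace δ u v n) : p * q ∈ nodeSpace δ (u ^ 2) (v ^ 2) (2 * n) := by
  rw [pow_two, pow_two, two_mul]
  exact nodeSpace_mul hp hq

theorem mul_mem_nodeSpace_sq_of_neg {δ u v : ℝ} {n : ℕ} {p q : ℝ[X]}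
    (hp : p ∈ nodeSpace δ u (-v) n) (hq : q ∈ nodeSpace δ u (-v) n) :
    p * q ∈ nodeSpace δ (u ^ 2) (v ^ 2) (2 * n) := by
  rw [← neg_sq v]
  exact mul_mem_nodeSpace_sq hp hq

/-- The functional whose kernel in `ℝ[t]_{≤ n}` is `nodeSpace δ u v n`. -/
def nodeFunctional (δ u v : ℝ) : ℝ[X] →ₗ[ℝ] ℝ := v • Polynomial.leval δ - u • Polynomial.leval (-δ)

theorem nodeFunctional_apply (δ u v : ℝ) (q : ℝ[X]) :
    nodeFunctional δ u v q = v * q.eval δ - u * q.eval (-δ) := by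
  simp [nodeFunctional, Polynomial.leval]

theorem nodeFunctional_eq_zero {δ u v : ℝ} {n : ℕ} {q : ℝ[X]} (hq : q ∈ nodeSpace δ u v n) :
    nodeFunctional δ u v q = 0 := by
  rw [nodeFunctional_apply, mul_comm, hq.2, mul_comm, sub_self]

/-- A positive semidefinite completion with a single free entry. The two node spaces meet in W, the
polynomials vanishing at ±δ, and each exceeds W by one dimension. If p and q span these complements
and are orthogonal to W, then the only undetermined value is the one at p q, which lies outside the
hyperplane; setting it to zero makes the form an orthogonal sum of nonnegative pieces. -/
theorem exists_square_positive_completion {δ u v : ℝ} (hδ : δ ≠ 0) (hu : u ≠ 0) (hv : v ≠ 0)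
    {n : ℕ} (hn : 1 ≤ n) (l : ℝ[X] →ₗ[ℝ] ℝ)
    (hA : ∀ q ∈ nodeSpace δ u v n, 0 ≤ l (q * q))
    (hB : ∀ q ∈ nodeSpace δ u (-v) n, 0 ≤ l (q * q)) :
    ∃ l' : ℝ[X] →ₗ[ℝ] ℝ, (∀ Q ∈ nodeSpace δ (u ^ 2) (v ^ 2) (2 * n), l' Q = l Q) ∧
      ∀ q : ℝ[X], q.natDegree ≤ n → 0 ≤ l' (q * q) := by
  set W : Submodule ℝ ℝ[X] := nodeSpace δ u v n ⊓ nodeSpace δ u (-v) n with hW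
  have : FiniteDimensional ℝ W := finiteDimensional_of_natDegree_le (n := n) fun q hq => hq.1.1
  have hW0 : ∀ q ∈ W, q.eval δ = 0 ∧ q.eval (-δ) = 0 := by
    rintro q ⟨⟨-, h1⟩, -, h2⟩
    have h3 : q.eval δ * v = 0 := by linarith
    have h4 : q.eval (-δ) * u = 0 := by linarith
    exact ⟨(mul_eq_zero.1 h3).resolve_right hv, (mul_eq_zero.1 h4).resolve_right hu⟩
  have hp : lineThrough δ u v ∈ nodeSpace δ u v n :=
    ⟨(natDegree_lineThrough_le _ _ _).trans hn, by
      rw [eval_lineThrough hδ, eval_lineThrough_neg hδ, mul_comm]⟩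
  have hq : lineThrough δ u (-v) ∈ nodeSpace δ u (-v) n :=
    ⟨(natDegree_lineThrough_le _ _ _).trans hn, by
      rw [eval_lineThrough hδ, eval_lineThrough_neg hδ, mul_comm]⟩
  obtain ⟨w₁, hw₁, ho₁⟩ := exists_orthogonal_projection (W := W) inf_le_left hA hp
  obtain ⟨w₂, hw₂, ho₂⟩ := exists_orthogonal_projection (W := W) inf_le_right hB hq
  set p := lineThrough δ u v - w₁ with hpdef
  set q := lineThrough δ u (-v) - w₂ with hqdef
  have hpA : p ∈ nodeSpace δ u v n := Submodule.sub_mem _ hp hw₁.1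
  have hqB : q ∈ nodeSpace δ u (-v) n := Submodule.sub_mem _ hq hw₂.2
  have ep : p.eval δ = u ∧ p.eval (-δ) = v := by
    rw [hpdef, eval_sub, eval_sub, eval_lineThrough hδ, eval_lineThrough_neg hδ,
      (hW0 _ hw₁).1, (hW0 _ hw₁).2, sub_zero, sub_zero]
    exact ⟨rfl, rfl⟩
  have eq : q.eval δ = u ∧ q.eval (-δ) = -v := by
    rw [hqdef, eval_sub, eval_sub, eval_lineThrough hδ, eval_lineThrough_neg hδ,
      (hW0 _ hw₂).1, (hW0 _ hw₂).2, sub_zero, sub_zero]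
    exact ⟨rfl, rfl⟩
  -- This is nonzero, so subtracting a multiple of `nodeFunctional` changes the value at p q freely
  -- and nothing on the hyperplane.
  have hφ : nodeFunctional δ (u ^ 2) (v ^ 2) (p * q) = 2 * (u ^ 2 * v ^ 2) := by
    rw [nodeFunctional_apply, eval_mul, eval_mul, ep.1, ep.2, eq.1, eq.2]
    ring
  have hc : 2 * (u ^ 2 * v ^ 2) ≠ 0 := by positivity
  refine ⟨l - (l (p * q) / (2 * (u ^ 2 * v ^ 2))) • nodeFunctional δ (u ^ 2) (v ^ 2),
    fun Q hQ => ?_, fun f hf => ?_⟩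
  · rw [LinearMap.sub_apply, LinearMap.smul_apply, nodeFunctional_eq_zero hQ, smul_zero, sub_zero]
  set l' := l - (l (p * q) / (2 * (u ^ 2 * v ^ 2))) • nodeFunctional δ (u ^ 2) (v ^ 2) with hl'
  have hl'Q : ∀ Q ∈ nodeSpace δ (u ^ 2) (v ^ 2) (2 * n), l' Q = l Q := fun Q hQ => by
    rw [hl', LinearMap.sub_apply, LinearMap.smul_apply, nodeFunctional_eq_zero hQ, smul_zero,
      sub_zero]
  have hpq : l' (p * q) = 0 := by
    rw [hl', LinearMap.sub_apply, LinearMap.smul_apply, hφ, smul_eq_mul, div_mul_cancel₀ _ hc,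
      sub_self]
  -- The coefficients solve (x + y) u = f(δ) and (x - y) v = f(-δ).
  obtain ⟨x, y, w, hw, rfl⟩ : ∃ x y : ℝ, ∃ w ∈ W, f = x • p + y • q + w := by
    refine ⟨(f.eval δ / u + f.eval (-δ) / v) / 2, (f.eval δ / u - f.eval (-δ) / v) / 2, _, ?_,
      (add_sub_cancel _ f).symm⟩
    have hz : ∀ g : ℝ[X], g.natDegree ≤ n → g.eval δ = 0 → g.eval (-δ) = 0 → g ∈ W := by
      intro g hg h1 h2
      exact ⟨⟨hg, by rw [h1, h2]; ring⟩, hg, by rw [h1, h2]; ring⟩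
    apply hz
    · refine (natDegree_sub_le _ _).trans (max_le hf ((natDegree_add_le _ _).trans (max_le ?_ ?_)))
      · exact (natDegree_smul_le _ _).trans hpA.1
      · exact (natDegree_smul_le _ _).trans hqB.1
    · simp only [eval_sub, eval_add, eval_smul, ep.1, eq.1, smul_eq_mul]
      field_simp
      ring
    · simp only [eval_sub, eval_add, eval_smul, ep.2, eq.2, smul_eq_mul]
      field_simp
      ring
  have hpw : l' (p * w) = 0 := by
    rw [hl'Q _ (mul_mem_nodeSpace_sq hpA hw.1)]; exact ho₁ w hw
  have hqw : l' (q * w) = 0 := by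
    rw [hl'Q _ (mul_mem_nodeSpace_sq_of_neg hqB hw.2)]; exact ho₂ w hw
  have hexp : (x • p + y • q + w) * (x • p + y • q + w) = (x ^ 2) • (p * p) + (y ^ 2) • (q * q) +
      w * w + (2 * x * y) • (p * q) + (2 * x) • (p * w) + (2 * y) • (q * w) := by
    simp only [Polynomial.smul_eq_C_mul, map_mul, map_pow, map_ofNat]
    ring
  rw [hexp]
  simp only [map_add, map_smul, hpq, hpw, hqw, smul_eq_mul, mul_zero, add_zero]
  rw [hl'Q _ (mul_mem_nodeSpace_sq hpA hpA), hl'Q _ (mul_mem_nodeSpace_sq_of_neg hqB hqB),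
    hl'Q _ (mul_mem_nodeSpace_sq hw.1 hw.1)]
  exact add_nonneg (add_nonneg (mul_nonneg (sq_nonneg x) (hA p hpA))
    (mul_nonneg (sq_nonneg y) (hB q hqB))) (hA w hw.1)

/-! ### Gaussian quadrature for singular positive semidefinite functionals -/

/-- `p` lies in the kernel of the form `(f, g) ↦ l (f g)` on `ℝ[t]_{≤ n}`. -/
def InKernel (l : ℝ[X] →ₗ[ℝ] ℝ) (n : ℕ) (p : ℝ[X]) : Prop :=
  p.natDegree ≤ n ∧ ∀ r : ℝ[X], r.natDegree ≤ n → l (p * r) = 0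

/-- `p` is a nonzero element of lowest degree in the kernel of the form on `ℝ[t]_{≤ n}`. -/
def IsMinimalKernel (l : ℝ[X] →ₗ[ℝ] ℝ) (n : ℕ) (p : ℝ[X]) : Prop :=
  InKernel l n p ∧ p ≠ 0 ∧ ∀ q, InKernel l n q → q ≠ 0 → p.natDegree ≤ q.natDegree

section Quadrature

variable {l : ℝ[X] →ₗ[ℝ] ℝ} {n : ℕ} {p : ℝ[X]}

theorem inKernel_of_sq (hpos : ∀ q : ℝ[X], q.natDegree ≤ n → 0 ≤ l (q * q))
    (hp : p.natDegree ≤ n) (h : l (p * p) = 0) : InKernel l n p :=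
  ⟨hp, fun _ hr => apply_mul_eq_zero_of_natDegree_le hpos hp hr h⟩

/-- Isotropic vectors of a positive form lie in its kernel, and (X p)² = p · (X² p), where X² p
still has degree at most n. -/
theorem InKernel.X_mul (hpos : ∀ q : ℝ[X], q.natDegree ≤ n → 0 ≤ l (q * q))
    (hp : InKernel l n p) (hdeg : p.natDegree + 2 ≤ n) : InKernel l n (X * p) := by
  have h1 : (X * p).natDegree ≤ p.natDegree + 1 := by
    refine natDegree_mul_le.trans ?_
    rw [natDegree_X, add_comm]
  refine inKernel_of_sq hpos (by omega) ?_
  have : X * p * (X * p) = p * (X * (X * p)) := by ring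
  rw [this]
  refine hp.2 _ (natDegree_mul_le.trans ?_)
  rw [natDegree_X]
  omega

theorem InKernel.X_pow_mul (hpos : ∀ q : ℝ[X], q.natDegree ≤ n → 0 ≤ l (q * q))
    (hp : InKernel l n p) (i : ℕ) (hdeg : p.natDegree + i + 1 ≤ n) : InKernel l n (X ^ i * p) := by
  induction i with
  | zero => simpa using hp
  | succ i ih =>
    rw [pow_succ', mul_assoc]
    refine (ih (by omega)).X_mul hpos ?_
    have : (X ^ i * p).natDegree ≤ i + p.natDegree := natDegree_mul_le.trans (by simp)
    omega

/-- Orthogonality extends to total degree 2 n - 1: for i > n, write p X^i as the kernel element X^(i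
- n) p times X^n. The total degree 2 n is out of reach, which is the origin of the atom at infinity
in the quadrature formula. -/
theorem InKernel.apply_mul (hpos : ∀ q : ℝ[X], q.natDegree ≤ n → 0 ≤ l (q * q))
    (hp : InKernel l n p) {g : ℝ[X]} (hg : p.natDegree + g.natDegree + 1 ≤ 2 * n) :
    l (p * g) = 0 := by
  rw [g.as_sum_range_C_mul_X_pow, Finset.mul_sum, map_sum]
  refine Finset.sum_eq_zero fun i hi => ?_
  have hi' : i ≤ g.natDegree := Nat.lt_succ_iff.1 (Finset.mem_range.1 hi)
  have h1 : p * (C (g.coeff i) * X ^ i) = g.coeff i • (p * X ^ i) := by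
    rw [Polynomial.smul_eq_C_mul]; ring
  rw [h1, map_smul]
  rcases le_or_gt i n with h | h
  · rw [hp.2 _ (by simpa using h), smul_zero]
  · have h2 : p * X ^ i = (X ^ (i - n) * p) * X ^ n := by
      rw [mul_right_comm, ← pow_add, Nat.sub_add_cancel h.le, mul_comm]
    rw [h2, (hp.X_pow_mul hpos (i - n) (by omega)).2 _ (by simp), smul_zero]

/-- Otherwise (X - t) r has square p r, so it is isotropic and is a kernel element of smaller
degree. -/
theorem IsMinimalKernel.not_sq_dvd (hpos : ∀ q : ℝ[X], q.natDegree ≤ n → 0 ≤ l (q * q))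
    (hp : IsMinimalKernel l n p) (t : ℝ) (r : ℝ[X]) : p ≠ (X - C t) * (X - C t) * r := by
  intro h
  have hr : r ≠ 0 := by rintro rfl; exact hp.2.1 (by simpa using h)
  have hX : (X - C t : ℝ[X]) ≠ 0 := X_sub_C_ne_zero t
  have h1 : p.natDegree = r.natDegree + 2 := by
    rw [h, natDegree_mul (mul_ne_zero hX hX) hr, natDegree_mul hX hX, natDegree_X_sub_C]
    ring
  have h2 : ((X - C t) * r).natDegree = r.natDegree + 1 := by
    rw [natDegree_mul hX hr, natDegree_X_sub_C, add_comm]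
  have h3 := hp.1.1
  have h4 : l ((X - C t) * r * ((X - C t) * r)) = 0 := by
    have : (X - C t) * r * ((X - C t) * r) = p * r := by rw [h]; ring
    rw [this]
    exact hp.1.2 r (by omega)
  have := hp.2.2 _ (inKernel_of_sq hpos (by omega) h4) (mul_ne_zero hX hr)
  omega

/-- Otherwise 0 = l(p r) is the sum of l(((X - b) r)²) and c l(r²), both nonnegative; so r is
isotropic and contradicts minimality. -/
theorem IsMinimalKernel.not_quadratic_dvd (hpos : ∀ q : ℝ[X], q.natDegree ≤ n → 0 ≤ l (q * q))
    (hp : IsMinimalKernel l n p) (b : ℝ) {c : ℝ} (hc : 0 < c) (r : ℝ[X]) :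
    p ≠ ((X - C b) * (X - C b) + C c) * r := by
  intro h
  have hr : r ≠ 0 := by rintro rfl; exact hp.2.1 (by simpa using h)
  have hX : (X - C b : ℝ[X]) ≠ 0 := X_sub_C_ne_zero b
  have hq : ((X - C b) * (X - C b) + C c : ℝ[X]).natDegree = 2 := by
    rw [natDegree_add_C, natDegree_mul hX hX, natDegree_X_sub_C]
  have h1 : p.natDegree = r.natDegree + 2 := by
    rw [h, natDegree_mul (by rintro h0; simp [h0] at hq) hr, hq, add_comm]
  have h3 := hp.1.1
  have h2 : ((X - C b) * r).natDegree = r.natDegree + 1 := by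
    rw [natDegree_mul hX hr, natDegree_X_sub_C, add_comm]
  have h4 : l ((X - C b) * r * ((X - C b) * r)) + c * l (r * r) = 0 := by
    have : (X - C b) * r * ((X - C b) * r) + c • (r * r) = p * r := by
      rw [h, Polynomial.smul_eq_C_mul]; ring
    rw [← smul_eq_mul c, ← map_smul, ← map_add, this]
    exact hp.1.2 r (by omega)
  have h5 := hpos ((X - C b) * r) (by omega)
  have h6 := hpos r (by omega)
  have h7 : l (r * r) = 0 := by
    have : c * l (r * r) ≤ 0 := by linarith
    nlinarith
  have := hp.2.2 _ (inKernel_of_sq hpos (by omega) h7) hr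
  omega

/-- All roots are real and simple: a nonconstant cofactor h of the nodal polynomial would have a
complex root, giving a repeated linear factor of p if it is real and a positive quadratic factor if
it is not. -/
theorem IsMinimalKernel.eq_C_mul_nodal (hpos : ∀ q : ℝ[X], q.natDegree ≤ n → 0 ≤ l (q * q))
    (hp : IsMinimalKernel l n p) :
    ∃ c : ℝ, c ≠ 0 ∧ p = C c * Lagrange.nodal p.roots.toFinset id := by
  have h1 : Lagrange.nodal p.roots.toFinset id ∣ p := by
    refine dvd_trans ?_ p.prod_multiset_X_sub_C_dvd
    rw [Lagrange.nodal_eq]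
    exact Multiset.prod_dvd_prod_of_le (Multiset.map_le_map (Multiset.dedup_le _))
  obtain ⟨h, hh⟩ := h1
  have hh0 : h ≠ 0 := by rintro rfl; exact hp.2.1 (by simpa using hh)
  by_cases hd : h.natDegree = 0
  · obtain ⟨c, rfl⟩ := natDegree_eq_zero.1 hd
    exact ⟨c, by simpa using hh0, by rw [mul_comm]; exact hh⟩
  exfalso
  obtain ⟨z, hz⟩ := Complex.exists_root (f := h.map (algebraMap ℝ ℂ)) (by
    rw [degree_map]
    exact natDegree_pos_iff_degree_pos.1 (Nat.pos_of_ne_zero hd))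
  have hz' : aeval z h = 0 := by rwa [IsRoot, eval_map_algebraMap] at hz
  by_cases him : z.im = 0
  · have hzr : z = algebraMap ℝ ℂ z.re := Complex.ext (by simp) (by simp [him])
    rw [hzr, aeval_algebraMap_apply, ← map_zero (algebraMap ℝ ℂ)] at hz'
    have h2 : h.IsRoot z.re := by
      have := (algebraMap ℝ ℂ).injective hz'
      rwa [coe_aeval_eq_eval] at this
    obtain ⟨r, hr⟩ := dvd_iff_isRoot.2 h2
    have h3 : z.re ∈ p.roots.toFinset := by
      rw [Multiset.mem_toFinset, mem_roots hp.2.1, hh]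
      exact root_mul_left_of_isRoot _ h2
    obtain ⟨s, hs⟩ := Lagrange.X_sub_C_dvd_nodal (R := ℝ) id h3
    refine hp.not_sq_dvd hpos z.re (s * r) ?_
    rw [hh, hs, hr]
    simp only [id]
    ring
  · obtain ⟨r, hr⟩ := h.quadratic_dvd_of_aeval_eq_zero_im_ne_zero hz' him
    refine hp.not_quadratic_dvd hpos z.re (c := z.im ^ 2) (by positivity)
      (Lagrange.nodal p.roots.toFinset id * r) ?_
    have h4 : ‖z‖ ^ 2 = z.re ^ 2 + z.im ^ 2 := by
      rw [← Complex.normSq_eq_norm_sq, Complex.normSq_apply]; ring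
    rw [h4] at hr
    conv_lhs => rw [hh, hr]
    simp only [map_mul, map_pow, map_add, map_ofNat]
    ring

/-- Division by the nodal polynomial; the remainder is the Lagrange interpolant of f. The degree
bound requires g ≠ 0 because the zero polynomial has `natDegree` 0. -/
theorem sum_eval_mul_basis (S : Finset ℝ) (f : ℝ[X]) :
    ∃ g : ℝ[X], f = (∑ t ∈ S, f.eval t • Lagrange.basis S id t) + Lagrange.nodal S id * g ∧
      (g ≠ 0 → S.card + g.natDegree ≤ f.natDegree) := by
  have hm : (Lagrange.nodal S (id : ℝ → ℝ)).Monic := Lagrange.nodal_monic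
  refine ⟨f /ₘ Lagrange.nodal S id, ?_, fun hg => ?_⟩
  · conv_lhs => rw [← modByMonic_add_div f (Lagrange.nodal S id)]
    congr 1
    rw [Lagrange.eq_interpolate_of_eval_eq (s := S) (v := (id : ℝ → ℝ)) (fun t => f.eval t)
      (f := f %ₘ Lagrange.nodal S id) Function.injective_id.injOn, Lagrange.interpolate_apply]
    · exact Finset.sum_congr rfl fun t _ => (Polynomial.smul_eq_C_mul _).symm
    · rw [← Lagrange.degree_nodal (s := S) (v := (id : ℝ → ℝ))]
      exact degree_modByMonic_lt _ hm
    · intro t ht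
      have := congrArg (eval t) (modByMonic_add_div f (Lagrange.nodal S (id : ℝ → ℝ)))
      have h0 : (Lagrange.nodal S (id : ℝ → ℝ)).eval t = 0 :=
        Lagrange.eval_nodal_at_node (v := (id : ℝ → ℝ)) ht
      rw [eval_add, eval_mul, h0, zero_mul, add_zero] at this
      exact this
  · rw [natDegree_divByMonic f hm, Lagrange.natDegree_nodal]
    have : ¬ f.natDegree < S.card := by
      intro hlt
      apply hg
      refine (divByMonic_eq_zero_iff hm).2 ?_
      rw [Lagrange.degree_nodal]
      exact lt_of_le_of_lt degree_le_natDegree (by exact_mod_cast hlt)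
    omega

/-- Gauss quadrature at the roots of p. It is exact below degree 2 n because l kills the multiples
of p there; the constant c is the defect on X^(2 n). Squares of Lagrange basis polynomials show that
the weights are nonnegative. -/
theorem IsMinimalKernel.exists_quadrature (hn : 1 ≤ n)
    (hpos : ∀ q : ℝ[X], q.natDegree ≤ n → 0 ≤ l (q * q)) (hp : IsMinimalKernel l n p) :
    ∃ (w : ℝ → ℝ) (c : ℝ), (∀ t, 0 ≤ w t) ∧ 0 ≤ c ∧ ∀ Q : ℝ[X], Q.natDegree ≤ 2 * n →
      l Q = (∑ t ∈ p.roots.toFinset, w t * Q.eval t) + c * Q.coeff (2 * n) := by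
  obtain ⟨a, ha, hpa⟩ := hp.eq_C_mul_nodal hpos
  set S := p.roots.toFinset with hS
  set N := Lagrange.nodal S (id : ℝ → ℝ) with hN
  have hdeg : p.natDegree = S.card := by
    rw [hpa, natDegree_C_mul ha, hN, Lagrange.natDegree_nodal]
  have hSn : S.card ≤ n := hdeg ▸ hp.1.1
  have hker : ∀ g : ℝ[X], S.card + g.natDegree + 1 ≤ 2 * n → l (N * g) = 0 := by
    intro g hg
    have h1 := hp.1.apply_mul hpos (g := g) (by omega)
    rw [hpa, ← Polynomial.smul_eq_C_mul, smul_mul_assoc, map_smul, smul_eq_mul] at h1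
    exact (mul_eq_zero.1 h1).resolve_left ha
  have hlow : ∀ f : ℝ[X], f.natDegree + 1 ≤ 2 * n →
      l f = ∑ t ∈ S, f.eval t * l (Lagrange.basis S id t) := by
    intro f hf
    obtain ⟨g, hg, hgd⟩ := sum_eval_mul_basis S f
    have h0 : l (N * g) = 0 := by
      by_cases h0 : g = 0
      · simp [h0]
      · exact hker g (by have := hgd h0; omega)
    conv_lhs => rw [hg]
    rw [map_add, h0, add_zero, map_sum]
    exact Finset.sum_congr rfl fun t _ => by rw [map_smul, smul_eq_mul]
  have hbdeg : ∀ t ∈ S, (Lagrange.basis S id t).natDegree = S.card - 1 := fun t ht =>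
    Lagrange.natDegree_basis Function.injective_id.injOn ht
  have hw : ∀ t ∈ S, 0 ≤ l (Lagrange.basis S id t) := by
    intro t ht
    have hc : 1 ≤ S.card := Finset.card_pos.2 ⟨t, ht⟩
    have h1 := hpos (Lagrange.basis S id t) (by rw [hbdeg t ht]; omega)
    rw [hlow _ (by
      have := natDegree_mul_le (p := Lagrange.basis S id t) (q := Lagrange.basis S id t)
      rw [hbdeg t ht] at this
      omega), Finset.sum_eq_single t] at h1
    · have h2 : (Lagrange.basis S (id : ℝ → ℝ) t).eval t = 1 :=
        Lagrange.eval_basis_self (v := (id : ℝ → ℝ)) Function.injective_id.injOn ht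
      rwa [eval_mul, h2, one_mul, one_mul] at h1
    · intro s hs hst
      have h2 : (Lagrange.basis S (id : ℝ → ℝ) t).eval s = 0 :=
        Lagrange.eval_basis_of_ne (v := (id : ℝ → ℝ)) hst.symm hs
      rw [eval_mul, h2, zero_mul, zero_mul]
    · exact fun h => absurd ht h
  have hw' : ∃ w : ℝ → ℝ, (∀ t, 0 ≤ w t) ∧ ∀ t ∈ S, w t = l (Lagrange.basis S id t) :=
    ⟨fun t => if t ∈ S then l (Lagrange.basis S id t) else 0, fun t => by
      dsimp only; split_ifs with h; exacts [hw t h, le_rfl], fun t ht => if_pos ht⟩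
  obtain ⟨w, hw0, hwS⟩ := hw'
  set c := l (X ^ (2 * n)) - ∑ t ∈ S, w t * t ^ (2 * n) with hc
  have hform : ∀ Q : ℝ[X], Q.natDegree ≤ 2 * n →
      l Q = (∑ t ∈ S, w t * Q.eval t) + c * Q.coeff (2 * n) := by
    intro Q hQ
    set f := Q - C (Q.coeff (2 * n)) * X ^ (2 * n) with hf
    have hfd : f.natDegree + 1 ≤ 2 * n := by
      have h1 : f.degree < (2 * n : ℕ) := by
        refine (degree_lt_iff_coeff_zero _ _).2 fun m hm => ?_
        rw [hf, coeff_sub, coeff_C_mul, coeff_X_pow]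
        rcases hm.eq_or_lt with rfl | hm
        · simp
        · rw [coeff_eq_zero_of_natDegree_lt (by omega), if_neg (by omega)]; simp
      by_cases h0 : f = 0
      · rw [h0]; simp; omega
      · have := (natDegree_lt_iff_degree_lt h0).2 h1
        omega
    have h2 : l Q = l f + Q.coeff (2 * n) * l (X ^ (2 * n)) := by
      rw [hf, map_sub, ← Polynomial.smul_eq_C_mul, map_smul, smul_eq_mul]; ring
    rw [h2, hlow f hfd, hc, sub_mul, Finset.sum_mul]
    have h3 : ∑ t ∈ S, w t * Q.eval t = (∑ t ∈ S, f.eval t * l (Lagrange.basis S id t)) +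
        ∑ t ∈ S, w t * t ^ (2 * n) * Q.coeff (2 * n) := by
      rw [← Finset.sum_add_distrib]
      refine Finset.sum_congr rfl fun t ht => ?_
      rw [← hwS t ht, hf, eval_sub, eval_mul, eval_C, eval_pow, eval_X]
      ring
    rw [h3]
    ring
  refine ⟨w, c, hw0, ?_, hform⟩
  -- A monic polynomial of degree n vanishing at all nodes: the quadrature of its square is exactly
  -- c.
  have hXN : (X ^ (n - S.card) * N).Monic := (monic_X_pow _).mul Lagrange.nodal_monic
  have hXNd : (X ^ (n - S.card) * N).natDegree = n := by
    rw [(monic_X_pow _).natDegree_mul Lagrange.nodal_monic, natDegree_X_pow,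
      Lagrange.natDegree_nodal]
    omega
  have h1 := hpos _ hXNd.le
  have h2 : (X ^ (n - S.card) * N * (X ^ (n - S.card) * N)).natDegree = 2 * n := by
    rw [hXN.natDegree_mul hXN, hXNd, two_mul]
  have h3 : (X ^ (n - S.card) * N * (X ^ (n - S.card) * N)).coeff (2 * n) = 1 := by
    rw [← h2]; exact hXN.mul hXN
  rw [hform _ h2.le, h3, Finset.sum_eq_zero, zero_add, mul_one] at h1
  · exact h1
  · intro t ht
    have h0 : N.eval t = 0 := Lagrange.eval_nodal_at_node (v := (id : ℝ → ℝ)) ht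
    rw [eval_mul, eval_mul, h0]
    ring

end Quadrature

/-! ### Finitely atomic functionals -/

/-- `Q ↦ ∑ w(t) Q(t)`, the sum over `t ∈ S`. -/
def atomic (S : Finset ℝ) (w : ℝ → ℝ) : ℝ[X] →ₗ[ℝ] ℝ := ∑ t ∈ S, w t • Polynomial.leval t

section Atomic

variable {S : Finset ℝ} {w : ℝ → ℝ} {δ u v : ℝ} {n : ℕ} {l : ℝ[X] →ₗ[ℝ] ℝ}

theorem atomic_apply (S : Finset ℝ) (w : ℝ → ℝ) (Q : ℝ[X]) :
    atomic S w Q = ∑ t ∈ S, w t * Q.eval t := by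
  simp [atomic, Polynomial.leval]

theorem eval_eq_zero_of_atomic_mul_self (hw : ∀ t ∈ S, 0 < w t) {q : ℝ[X]}
    (h : atomic S w (q * q) = 0) : ∀ t ∈ S, q.eval t = 0 := by
  rw [atomic_apply, Finset.sum_eq_zero_iff_of_nonneg fun t ht =>
    mul_nonneg (hw t ht).le (by rw [eval_mul]; exact mul_self_nonneg _)] at h
  intro t ht
  have h1 := (mul_eq_zero.1 (h t ht)).resolve_left (hw t ht).ne'
  rw [eval_mul] at h1
  exact mul_self_eq_zero.1 h1

theorem atomic_mul_eq_zero {q : ℝ[X]} (hq : ∀ t ∈ S, q.eval t = 0) (r : ℝ[X]) :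
    atomic S w (q * r) = 0 := by
  rw [atomic_apply]
  exact Finset.sum_eq_zero fun t ht => by rw [eval_mul, hq t ht]; ring

theorem eval_nodal_eq_zero {t : ℝ} (ht : t ∈ S) : (Lagrange.nodal S (id : ℝ → ℝ)).eval t = 0 :=
  Lagrange.eval_nodal_at_node (v := (id : ℝ → ℝ)) ht

theorem eval_nodal_ne_zero {t : ℝ} (ht : t ∉ S) : (Lagrange.nodal S (id : ℝ → ℝ)).eval t ≠ 0 :=
  Lagrange.eval_nodal_not_at_node fun i hi h => ht (by rw [h]; exact hi)

theorem card_le_natDegree_of_eval_eq_zero {q : ℝ[X]} (hq0 : q ≠ 0)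
    (hq : ∀ t ∈ S, q.eval t = 0) : S.card ≤ q.natDegree := by
  refine (Finset.card_le_card fun t ht => ?_).trans
    ((Multiset.toFinset_card_le _).trans q.card_roots')
  rw [Multiset.mem_toFinset, mem_roots hq0]
  exact hq t ht

theorem isMinimalKernel_nodal (hw : ∀ t ∈ S, 0 < w t) (hS : S.card ≤ n)
    (hl : ∀ Q : ℝ[X], Q.natDegree ≤ 2 * n → l Q = atomic S w Q) :
    IsMinimalKernel l n (Lagrange.nodal S id) := by
  have hdeg : ∀ {q r : ℝ[X]}, q.natDegree ≤ n → r.natDegree ≤ n →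
      (q * r).natDegree ≤ 2 * n := fun hq hr => natDegree_mul_le.trans (by omega)
  have hN : (Lagrange.nodal S (id : ℝ → ℝ)).natDegree = S.card := Lagrange.natDegree_nodal
  refine ⟨⟨hN.trans_le hS, fun r hr => ?_⟩, Lagrange.nodal_ne_zero, fun q hq hq0 => ?_⟩
  · rw [hl _ (hdeg (hN.trans_le hS) hr)]
    exact atomic_mul_eq_zero (fun t ht => eval_nodal_eq_zero ht) r
  · rw [hN]
    refine card_le_natDegree_of_eval_eq_zero hq0 (eval_eq_zero_of_atomic_mul_self hw ?_)
    rw [← hl _ (hdeg hq.1 hq.1)]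
    exact hq.2 q hq.1

/-- A square positive functional that agrees with a finitely atomic one on a hyperplane defined by
values at `δ` and `-δ` agrees with it, if some nonzero test function vanishes on the atoms. -/
theorem eq_atomic_of_eq_on_nodeSpace (hδ : δ ≠ 0) (hu : u ≠ 0) (hv : v ≠ 0) (hn : 1 ≤ n)
    (h1S : δ ∉ S) (h2S : -δ ∉ S) (hpos : ∀ q : ℝ[X], q.natDegree ≤ n → 0 ≤ l (q * q))
    (hl : ∀ Q ∈ nodeSpace δ (u ^ 2) (v ^ 2) (2 * n), l Q = atomic S w Q) {q : ℝ[X]}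
    (hq : q ∈ nodeSpace δ u v n ∨ q ∈ nodeSpace δ u (-v) n) (hq0 : q ≠ 0)
    (hqS : ∀ t ∈ S, q.eval t = 0) (Q : ℝ[X]) (hQ : Q.natDegree ≤ 2 * n) :
    l Q = atomic S w Q := by
  set φ := nodeFunctional δ (u ^ 2) (v ^ 2) with hφ
  -- Two functionals that agree on the hyperplane, the kernel of φ, differ by a multiple of φ in
  -- these degrees; it remains to show that the multiple is zero.
  obtain ⟨s, hs⟩ : ∃ s : ℝ, ∀ Q : ℝ[X], Q.natDegree ≤ 2 * n →
      l Q = atomic S w Q + s * φ Q := by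
    set E := lineThrough δ 1 0 with hE
    have hφE : φ E = v ^ 2 := by
      rw [hφ, nodeFunctional_apply, hE, eval_lineThrough hδ, eval_lineThrough_neg hδ]; ring
    refine ⟨(l E - atomic S w E) / v ^ 2, fun Q hQ => ?_⟩
    have h1 : Q - (φ Q / v ^ 2) • E ∈ nodeSpace δ (u ^ 2) (v ^ 2) (2 * n) := by
      refine ⟨(natDegree_sub_le _ _).trans (max_le hQ ((natDegree_smul_le _ _).trans
        ((natDegree_lineThrough_le _ _ _).trans (by omega)))), ?_⟩
      rw [eval_sub, eval_sub, eval_smul, eval_smul, hE, eval_lineThrough hδ,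
        eval_lineThrough_neg hδ, hφ, nodeFunctional_apply, smul_eq_mul, smul_eq_mul]
      field_simp
      ring
    have h2 := hl _ h1
    rw [map_sub, map_sub, map_smul, map_smul, smul_eq_mul, smul_eq_mul] at h2
    have hv2 : v ^ 2 ≠ 0 := pow_ne_zero 2 hv
    field_simp at h2 ⊢
    linarith
  suffices h : s = 0 by rw [hs Q hQ, h, zero_mul, add_zero]
  have hmul : ∀ {q r : ℝ[X]}, q.natDegree ≤ n → r.natDegree ≤ n →
      (q * r).natDegree ≤ 2 * n := fun hq hr => natDegree_mul_le.trans (by omega)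
  have hqn : q.natDegree ≤ n := by rcases hq with h | h <;> exact h.1
  have hcard := card_le_natDegree_of_eval_eq_zero hq0 hqS
  rcases Nat.lt_or_ge S.card n with hlt | hge
  · set N := Lagrange.nodal S (id : ℝ → ℝ) with hN
    -- With fewer than n atoms there is room for a linear factor with arbitrary values at ±δ. On the
    -- resulting squares the atoms contribute nothing and s φ is s times an indefinite quadratic
    -- form, so s = 0.
    have key : ∀ x y : ℝ, 0 ≤ s * (v ^ 2 * (N.eval δ * x) ^ 2 - u ^ 2 * (N.eval (-δ) * y) ^ 2) := by
      intro x y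
      have hd : (N * lineThrough δ x y).natDegree ≤ n := by
        refine natDegree_mul_le.trans ?_
        have h1 := natDegree_lineThrough_le δ x y
        have h2 : N.natDegree = S.card := Lagrange.natDegree_nodal
        omega
      have h1 := hpos _ hd
      rw [hs _ (hmul hd hd), atomic_mul_eq_zero (fun t ht => by
        rw [eval_mul, hN, eval_nodal_eq_zero ht, zero_mul]), zero_add, hφ,
        nodeFunctional_apply] at h1
      simp only [eval_mul, eval_lineThrough hδ, eval_lineThrough_neg hδ] at h1
      linarith
    have h1 := key 1 0
    have h2 := key 0 1
    have h3 : 0 < v ^ 2 * (N.eval δ) ^ 2 := by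
      have := eval_nodal_ne_zero h1S
      positivity
    have h4 : 0 < u ^ 2 * (N.eval (-δ)) ^ 2 := by
      have := eval_nodal_ne_zero h2S
      positivity
    apply le_antisymm
    · by_contra! hc
      nlinarith [mul_pos hc h4]
    · by_contra! hc
      nlinarith [mul_pos (neg_pos.2 hc) h3]
  -- With n atoms, q has no further root. Since q² lies in the hyperplane, q is isotropic for l,
  -- hence in its kernel; pairing it with the line that is 0 at δ and 1 at -δ isolates s.
  · have hroot : q.eval (-δ) ≠ 0 := by
      intro h0
      have := card_le_natDegree_of_eval_eq_zero (S := insert (-δ) S) hq0 (by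
        intro t ht
        rcases Finset.mem_insert.1 ht with rfl | ht
        exacts [h0, hqS t ht])
      rw [Finset.card_insert_of_notMem h2S] at this
      omega
    have hφq : φ (q * q) = 0 := by
      rcases hq with h | h
      · exact nodeFunctional_eq_zero (mul_mem_nodeSpace_sq h h)
      · exact nodeFunctional_eq_zero (mul_mem_nodeSpace_sq_of_neg h h)
    have h0 : l (q * q) = 0 := by
      rw [hs _ (hmul hqn hqn), hφq, atomic_mul_eq_zero hqS, mul_zero, add_zero]
    have hL := (natDegree_lineThrough_le δ 0 1).trans hn
    have h1 := apply_mul_eq_zero_of_natDegree_le hpos hqn hL h0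
    rw [hs _ (hmul hqn hL), atomic_mul_eq_zero hqS, hφ, nodeFunctional_apply, eval_mul, eval_mul,
      eval_lineThrough hδ, eval_lineThrough_neg hδ] at h1
    have h2 : s * (u ^ 2 * q.eval (-δ)) = 0 := by linarith
    exact (mul_eq_zero.1 h2).resolve_right (mul_ne_zero (pow_ne_zero 2 hu) hroot)

/-- The number of free roots beyond S is n - |S|. With none, q itself has degree n; with one, a
suitable extra root adjusts the ratio of the values at ±δ; with two or more, the roots ±δ are added,
and the condition at the nodes becomes trivial. -/
theorem exists_coeff_ne_zero_of_vanishing (hδ : δ ≠ 0) (hv : v ≠ 0) (h1S : δ ∉ S) {q : ℝ[X]}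
    (hq : q ∈ nodeSpace δ u v n ∨ q ∈ nodeSpace δ u (-v) n) (hq0 : q ≠ 0)
    (hqS : ∀ t ∈ S, q.eval t = 0) :
    (∃ r ∈ nodeSpace δ u v n, r.coeff n ≠ 0 ∧ ∀ t ∈ S, r.eval t = 0) ∨
      ∃ r ∈ nodeSpace δ u (-v) n, r.coeff n ≠ 0 ∧ ∀ t ∈ S, r.eval t = 0 := by
  have hqn : q.natDegree ≤ n := by rcases hq with h | h <;> exact h.1
  have hcard := card_le_natDegree_of_eval_eq_zero hq0 hqS
  set N := Lagrange.nodal S (id : ℝ → ℝ) with hN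
  have hNd : N.natDegree = S.card := Lagrange.natDegree_nodal
  have hNm : N.Monic := Lagrange.nodal_monic
  obtain hc | hc | hc : S.card = n ∨ S.card + 1 = n ∨ S.card + 2 ≤ n := by omega
  · have hqc : q.coeff n ≠ 0 := by
      have : q.natDegree = n := by omega
      rw [← this]
      exact leadingCoeff_ne_zero.2 hq0
    exact hq.imp (fun h => ⟨q, h, hqc, hqS⟩) fun h => ⟨q, h, hqc, hqS⟩
  · have hr : ∀ c : ℝ, (N * (X - C c)).natDegree ≤ n ∧ (N * (X - C c)).coeff n ≠ 0 ∧
        ∀ t ∈ S, (N * (X - C c)).eval t = 0 := by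
      intro c
      have hd : (N * (X - C c)).natDegree = n := by
        rw [hNm.natDegree_mul (monic_X_sub_C c), hNd, natDegree_X_sub_C, hc]
      refine ⟨hd.le, ?_, fun t ht => by rw [eval_mul, hN, eval_nodal_eq_zero ht, zero_mul]⟩
      rw [← hd, coeff_natDegree, (hNm.mul (monic_X_sub_C c)).leadingCoeff]
      exact one_ne_zero
    set x := N.eval δ * v with hx
    set y := N.eval (-δ) * u with hy
    have hx0 : x ≠ 0 := mul_ne_zero (eval_nodal_ne_zero h1S) hv
    -- For N (X - c) the condition at ±δ is linear in c, with solution -δ (x + y) / (y - x) for the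
    -- ratio u : v and δ (x - y) / (x + y) for the ratio u : -v. As x ≠ 0, the two denominators
    -- cannot both vanish.
    by_cases hxy : x = y
    · right
      have hs : x + y ≠ 0 := by rw [← hxy]; intro h; apply hx0; linarith
      obtain ⟨h1, h2, h3⟩ := hr (δ * (x - y) / (x + y))
      refine ⟨_, ⟨h1, ?_⟩, h2, h3⟩
      have : (N.eval δ * (δ - δ * (x - y) / (x + y))) * -v =
        (N.eval (-δ) * (-δ - δ * (x - y) / (x + y))) * u := by
        calc _ = -(x * (δ - δ * (x - y) / (x + y))) := by rw [hx]; ring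
          _ = y * (-δ - δ * (x - y) / (x + y)) := by field_simp; ring
          _ = _ := by rw [hy]; ring
      simpa using this
    · left
      have hs : y - x ≠ 0 := fun h => hxy (by linarith)
      obtain ⟨h1, h2, h3⟩ := hr (-(δ * (x + y)) / (y - x))
      refine ⟨_, ⟨h1, ?_⟩, h2, h3⟩
      have : (N.eval δ * (δ - -(δ * (x + y)) / (y - x))) * v =
        (N.eval (-δ) * (-δ - -(δ * (x + y)) / (y - x))) * u := by
        calc _ = x * (δ - -(δ * (x + y)) / (y - x)) := by rw [hx]; ring
          _ = y * (-δ - -(δ * (x + y)) / (y - x)) := by field_simp; ring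
          _ = _ := by rw [hy]; ring
      simpa using this
  · left
    have hm1 : ((X - C δ) * (X + C δ) : ℝ[X]).Monic := (monic_X_sub_C δ).mul (monic_X_add_C δ)
    have hm : (N * ((X - C δ) * (X + C δ)) * X ^ (n - S.card - 2)).Monic :=
      (hNm.mul hm1).mul (monic_X_pow _)
    have hd : (N * ((X - C δ) * (X + C δ)) * X ^ (n - S.card - 2)).natDegree = n := by
      rw [(hNm.mul hm1).natDegree_mul (monic_X_pow _), hNm.natDegree_mul hm1,
        (monic_X_sub_C δ).natDegree_mul (monic_X_add_C δ), hNd, natDegree_X_sub_C,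
        natDegree_X_add_C, natDegree_X_pow]
      omega
    refine ⟨_, ⟨hd.le, ?_⟩, ?_, fun t ht => ?_⟩
    · simp
    · conv => enter [1, 2]; rw [← hd]
      rw [coeff_natDegree, hm.leadingCoeff]
      exact one_ne_zero
    · rw [eval_mul, eval_mul, hN, eval_nodal_eq_zero ht]
      ring

end Atomic

/-! ### Rank of the restriction of a positive semidefinite form -/

section Rank

variable {V : Type*} [AddCommGroup V] [Module ℝ V] {B : LinearMap.BilinForm ℝ V}

theorem mem_ker_of_apply_self_eq_zero (hsymm : ∀ x y, B x y = B y x) (hpos : IsPos B) {x : V}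
    (h : B x x = 0) : x ∈ LinearMap.ker B := by
  refine LinearMap.mem_ker.2 (LinearMap.ext fun y => ?_)
  refine eq_zero_of_quadratic_nonneg (hpos y) fun c => ?_
  have := hpos (x + c • y)
  simp only [map_add, LinearMap.add_apply, map_smul, LinearMap.smul_apply, smul_eq_mul, h,
    hsymm y x] at this
  linarith

/-- By positivity the kernel of the restricted form is U ∩ ker B, since its elements are isotropic
for B; the rest is a dimension count. -/
theorem formRank_eq_restrict_iff [FiniteDimensional ℝ V] (hsymm : ∀ x y, B x y = B y x)
    (hpos : IsPos B) (U : Submodule ℝ V) :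
    formRank B = formRank (B.restrict U) ↔ U ⊔ LinearMap.ker B = ⊤ := by
  have hker : LinearMap.ker (B.restrict U) = (LinearMap.ker B).comap U.subtype := by
    ext x
    constructor
    · intro hx
      exact mem_ker_of_apply_self_eq_zero hsymm hpos (by
        have := LinearMap.congr_fun (LinearMap.mem_ker.1 hx) x
        exact this)
    · intro hx
      refine LinearMap.mem_ker.2 (LinearMap.ext fun y => ?_)
      exact LinearMap.congr_fun (LinearMap.mem_ker.1 (show (x : V) ∈ LinearMap.ker B from hx)) y
  have h1 := LinearMap.finrank_range_add_finrank_ker B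
  have h2 := LinearMap.finrank_range_add_finrank_ker (B.restrict U)
  have h3 : Module.finrank ℝ (LinearMap.ker (B.restrict U)) =
      Module.finrank ℝ (U ⊓ LinearMap.ker B : Submodule ℝ V) := by
    rw [hker, ← Submodule.finrank_map_subtype_eq U, Submodule.map_comap_subtype]
  have h4 := Submodule.finrank_sup_add_finrank_inf_eq U (LinearMap.ker B)
  have h5 : U ⊔ LinearMap.ker B = ⊤ ↔
      Module.finrank ℝ (U ⊔ LinearMap.ker B : Submodule ℝ V) = Module.finrank ℝ V :=
    ⟨fun h => by rw [h, finrank_top], Submodule.eq_top_of_finrank_eq⟩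
  rw [h5]
  unfold formRank
  omega

/-- Restriction to a hyperplane does not change the rank iff the kernel sticks out of the
hyperplane. -/
theorem formRank_eq_restrict_iff_exists [FiniteDimensional ℝ V] (hsymm : ∀ x y, B x y = B y x)
    (hpos : IsPos B) {U : Submodule ℝ V} (hU : ∀ x ∉ U, ∀ y, ∃ c : ℝ, y - c • x ∈ U)
    (hne : ∃ x, x ∉ U) :
    formRank B = formRank (B.restrict U) ↔ ∃ x ∈ LinearMap.ker B, x ∉ U := by
  rw [formRank_eq_restrict_iff hsymm hpos]
  constructor
  · intro h
    by_contra! hc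
    obtain ⟨x, hx⟩ := hne
    have hle : U ⊔ LinearMap.ker B ≤ U := sup_le le_rfl hc
    rw [h] at hle
    exact hx (hle trivial)
  · rintro ⟨x, hx, hx0⟩
    refine eq_top_iff.2 fun y _ => ?_
    obtain ⟨c, hc⟩ := hU x hx0 y
    rw [← sub_add_cancel y (c • x)]
    exact Submodule.add_mem_sup hc (Submodule.smul_mem _ _ hx)

end Rank

/-! ### Functions on the curve as polynomials in the parameter -/

/-- The numerator `-a t + e` of the first coordinate of the parametrization. -/
def num (a e : ℝ) : ℝ[X] := -(C a * X) + C e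

theorem natDegree_num_le (a e : ℝ) : (num a e).natDegree ≤ 1 := by
  unfold num
  compute_degree

theorem eval_num (a e t : ℝ) : (num a e).eval t = e - a * t := by
  simp only [num, eval_add, eval_neg, eval_mul, eval_C, eval_X]
  ring

theorem eval_h2 (d t : ℝ) : (h2 d).eval t = t ^ 2 - d := by
  simp [h2]

theorem algebraMap_h2_pow_ne_zero (d : ℝ) (m : ℕ) :
    algebraMap ℝ[X] (RatFunc ℝ) (h2 d ^ m) ≠ 0 :=
  RatFunc.algebraMap_ne_zero (pow_ne_zero _ (h2_ne_zero d))

theorem h3_mul_h2 (a d e : ℝ) :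
    h3 a d e * algebraMap ℝ[X] (RatFunc ℝ) (h2 d) = algebraMap ℝ[X] (RatFunc ℝ) (num a e) :=
  div_mul_cancel₀ _ (RatFunc.algebraMap_ne_zero (h2_ne_zero d))

/-- The line `y = c` is not a component of the cubic if the cubic is irreducible. -/
theorem eval_num_ne_zero {a d e c : ℝ} (hP : Irreducible (cubic a d e)) (hc : c ^ 2 = d) :
    (num a e).eval c ≠ 0 := by
  intro h
  rw [eval_num] at h
  -- If e = a c and d = c², the cubic is (y - c)(x (y + c) + a). Each factor has a real zero, so
  -- neither is a unit.
  have hfac : cubic a d e = (MvPolynomial.X 1 - MvPolynomial.C c) *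
      (MvPolynomial.X 0 * (MvPolynomial.X 1 + MvPolynomial.C c) + MvPolynomial.C a) := by
    have he : e = a * c := by linarith
    rw [cubic, ← hc, he, map_pow, map_mul]
    ring
  have hunit : ∀ (p : MvPolynomial (Fin 2) ℝ) (z : Fin 2 → ℝ), MvPolynomial.eval z p = 0 →
      ¬ IsUnit p := fun p z hz hu => by
    have := hu.map (MvPolynomial.eval z)
    rw [hz] at this
    exact not_isUnit_zero this
  rcases hP.isUnit_or_isUnit hfac with hu | hu
  · exact hunit _ ![0, c] (by simp) hu
  · exact hunit _ ![-a, 1 - c] (by simp) hu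

/-- The point of the curve with parameter `t`. -/
def curvePoint (a d e t : ℝ) : Fin 2 → ℝ := ![(num a e).eval t / (t ^ 2 - d), t]

theorem curvePoint_mem (a e : ℝ) {d t : ℝ} (ht : t ^ 2 ≠ d) :
    curvePoint a d e t ∈ curve a d e := by
  have h : t ^ 2 - d ≠ 0 := sub_ne_zero.2 ht
  simp only [curve, Set.mem_ofPred_eq, cubic, curvePoint, eval_num, map_sub, map_add, map_mul,
    map_pow, MvPolynomial.eval_X, MvPolynomial.eval_C, Matrix.cons_val_zero, Matrix.cons_val_one]
  field_simp
  ring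

theorem sq_ne_of_mem_curve {a d e : ℝ} (hP : Irreducible (cubic a d e)) {z : Fin 2 → ℝ}
    (hz : z ∈ curve a d e) : z 1 ^ 2 ≠ d := by
  intro h
  apply eval_num_ne_zero hP h
  have hz' : MvPolynomial.eval z (cubic a d e) = 0 := hz
  simp only [cubic, map_sub, map_add, map_mul, map_pow, MvPolynomial.eval_X,
    MvPolynomial.eval_C] at hz'
  rw [eval_num]
  rw [h] at hz'
  linarith

theorem eq_curvePoint {a d e : ℝ} (hP : Irreducible (cubic a d e)) {z : Fin 2 → ℝ}
    (hz : z ∈ curve a d e) : z = curvePoint a d e (z 1) := by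
  have h := sub_ne_zero.2 (sq_ne_of_mem_curve hP hz)
  have hz' : MvPolynomial.eval z (cubic a d e) = 0 := hz
  simp only [cubic, map_sub, map_add, map_mul, map_pow, MvPolynomial.eval_X,
    MvPolynomial.eval_C] at hz'
  have h0 : z 0 = (num a e).eval (z 1) / (z 1 ^ 2 - d) := by
    rw [eval_num, eq_div_iff h]
    linarith
  funext i
  fin_cases i
  · exact h0
  · rfl

/-- Denominators are cleared with the same M and N in ℝ(t) and pointwise on the curve, so that
identities pass between the two without evaluating rational functions. -/
theorem exists_pullback_eq (a d e : ℝ) (p : MvPolynomial (Fin 2) ℝ) :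
    ∃ (M : ℕ) (N : ℝ[X]), pullback a d e p * algebraMap ℝ[X] (RatFunc ℝ) (h2 d ^ M) =
        algebraMap ℝ[X] (RatFunc ℝ) N ∧
      ∀ t, t ^ 2 ≠ d →
        MvPolynomial.eval (curvePoint a d e t) p * (t ^ 2 - d) ^ M = N.eval t := by
  induction p using MvPolynomial.induction_on with
  | C c =>
    refine ⟨0, C c, ?_, fun t _ => by simp⟩
    rw [pullback, MvPolynomial.aeval_C, pow_zero, map_one, mul_one, RatFunc.algebraMap_C]
    rfl
  | add p q hp hq =>
    obtain ⟨M₁, N₁, h₁, h₁'⟩ := hp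
    obtain ⟨M₂, N₂, h₂, h₂'⟩ := hq
    refine ⟨M₁ + M₂, N₁ * h2 d ^ M₂ + N₂ * h2 d ^ M₁, ?_, fun t ht => ?_⟩
    · rw [map_add, map_add, map_mul, map_mul, ← h₁, ← h₂, pow_add, map_mul]
      ring
    · rw [map_add, eval_add, eval_mul, eval_mul, ← h₁' t ht, ← h₂' t ht, eval_pow, eval_pow,
        eval_h2]
      ring
  | mul_X p i hp =>
    obtain ⟨M, N, h, h'⟩ := hp
    fin_cases i
    · refine ⟨M + 1, N * num a e, ?_, fun t ht => ?_⟩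
      · have hx : pullback a d e (MvPolynomial.X 0) = h3 a d e := by simp [pullback]
        change pullback a d e (p * MvPolynomial.X 0) * _ = _
        rw [map_mul, hx, pow_succ, map_mul, map_mul, ← h, ← h3_mul_h2]
        ring
      · have h0 : t ^ 2 - d ≠ 0 := sub_ne_zero.2 ht
        change MvPolynomial.eval _ (p * MvPolynomial.X 0) * _ = _
        rw [map_mul, MvPolynomial.eval_X, eval_mul, ← h' t ht, pow_succ]
        simp only [curvePoint, Matrix.cons_val_zero]
        field_simp
    · refine ⟨M, N * X, ?_, fun t ht => ?_⟩
      · have hx : pullback a d e (MvPolynomial.X 1) = RatFunc.X := by simp [pullback]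
        change pullback a d e (p * MvPolynomial.X 1) * _ = _
        rw [map_mul, hx, map_mul, RatFunc.algebraMap_X, ← h]
        ring
      · change MvPolynomial.eval _ (p * MvPolynomial.X 1) * _ = _
        have h1 : curvePoint a d e t 1 = t := rfl
        rw [map_mul, MvPolynomial.eval_X, eval_mul, ← h' t ht, eval_X, h1]
        ring

theorem eq_zero_of_eval_eq_zero {d : ℝ} {N : ℝ[X]} (h : ∀ t, t ^ 2 ≠ d → N.eval t = 0) :
    N = 0 := by
  -- The factor t² - d absorbs the excluded parameters.
  have h1 : h2 d * N = 0 := by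
    refine Polynomial.funext fun t => ?_
    rw [eval_mul, eval_h2, eval_zero]
    by_cases ht : t ^ 2 = d
    · rw [ht, sub_self, zero_mul]
    · rw [h t ht, mul_zero]
  exact (mul_eq_zero.1 h1).resolve_left (h2_ne_zero d)

theorem pullback_eq_zero_of_mem {a d e : ℝ} {p : MvPolynomial (Fin 2) ℝ}
    (hp : p ∈ MvPolynomial.vanishingIdeal ℝ (curve a d e)) : pullback a d e p = 0 := by
  obtain ⟨M, N, h, h'⟩ := exists_pullback_eq a d e p
  have hN : N = 0 := eq_zero_of_eval_eq_zero (d := d) fun t ht => by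
    rw [← h' t ht, ← MvPolynomial.coe_aeval_eq_eval, RingHom.coe_coe,
      (MvPolynomial.mem_vanishingIdeal_iff).1 hp _ (curvePoint_mem a e ht), zero_mul]
  rw [hN, map_zero] at h
  exact (mul_eq_zero.1 h).resolve_right (algebraMap_h2_pow_ne_zero d M)

/-- The map `ℝ[C] → ℝ(t)` induced by the parametrization. -/
def toRatFunc (a d e : ℝ) : CoordRing (curve a d e) →ₐ[ℝ] RatFunc ℝ :=
  Ideal.Quotient.liftₐ _ (pullback a d e) fun _ hp => pullback_eq_zero_of_mem hp

theorem toRatFunc_mk (a d e : ℝ) (p : MvPolynomial (Fin 2) ℝ) :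
    toRatFunc a d e (Ideal.Quotient.mk _ p) = pullback a d e p := rfl

/-- Irreducibility enters because every point of the curve must be reached by the parametrization.
-/
theorem toRatFunc_injective {a d e : ℝ} (hP : Irreducible (cubic a d e)) :
    Function.Injective (toRatFunc a d e) := by
  rw [injective_iff_map_eq_zero]
  intro f hf
  obtain ⟨p, rfl⟩ := Ideal.Quotient.mk_surjective f
  rw [toRatFunc_mk] at hf
  obtain ⟨M, N, h, h'⟩ := exists_pullback_eq a d e p
  rw [hf, zero_mul] at h
  have hN : N = 0 := by
    rw [← map_zero (algebraMap ℝ[X] (RatFunc ℝ))] at h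
    exact (RatFunc.algebraMap_injective ℝ h).symm
  rw [Ideal.Quotient.eq_zero_iff_mem, MvPolynomial.mem_vanishingIdeal_iff]
  intro z hz
  have hz1 := sq_ne_of_mem_curve hP hz
  have h1 := h' _ hz1
  rw [← eq_curvePoint hP hz, hN, eval_zero] at h1
  exact (mul_eq_zero.1 h1).resolve_right (pow_ne_zero _ (sub_ne_zero.2 hz1))

/-- `f = q / (t² - d)^m` along the parametrization. -/
def IsRep {a d e : ℝ} (m : ℕ) (f : CoordRing (curve a d e)) (q : ℝ[X]) : Prop :=
  toRatFunc a d e f * algebraMap ℝ[X] (RatFunc ℝ) (h2 d ^ m) = algebraMap ℝ[X] (RatFunc ℝ) q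

section IsRep

variable {a d e : ℝ} {m n : ℕ} {f g : CoordRing (curve a d e)} {q r : ℝ[X]}

theorem IsRep.add (hf : IsRep m f q) (hg : IsRep m g r) : IsRep m (f + g) (q + r) := by
  unfold IsRep at *
  rw [map_add, add_mul, hf, hg, map_add]

theorem algebraMap_smul_ratFunc (c : ℝ) (q : ℝ[X]) :
    algebraMap ℝ[X] (RatFunc ℝ) (c • q) = c • algebraMap ℝ[X] (RatFunc ℝ) q := by
  rw [Polynomial.smul_eq_C_mul, map_mul, RatFunc.algebraMap_C, RatFunc.smul_eq_C_mul]

theorem IsRep.smul (c : ℝ) (hf : IsRep m f q) : IsRep m (c • f) (c • q) := by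
  unfold IsRep at *
  rw [map_smul, smul_mul_assoc, hf, algebraMap_smul_ratFunc]

theorem IsRep.zero : IsRep (a := a) (d := d) (e := e) m 0 0 := by
  unfold IsRep
  rw [map_zero, map_zero, zero_mul]

theorem IsRep.sub (hf : IsRep m f q) (hg : IsRep m g r) : IsRep m (f - g) (q - r) := by
  unfold IsRep at *
  rw [map_sub, sub_mul, hf, hg, map_sub]

theorem IsRep.mul (hf : IsRep m f q) (hg : IsRep n g r) : IsRep (m + n) (f * g) (q * r) := by
  unfold IsRep at *
  rw [map_mul, map_mul, ← hf, ← hg, pow_add, map_mul]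
  ring

theorem IsRep.mul_self_index (hf : IsRep m f q) (hg : IsRep m g r) :
    IsRep (2 * m) (f * g) (q * r) := two_mul m ▸ hf.mul hg

theorem IsRep.pow (hf : IsRep m f q) (i : ℕ) : IsRep (m * i) (f ^ i) (q ^ i) := by
  unfold IsRep at *
  rw [map_pow, map_pow _ q, ← hf, mul_pow, pow_mul, map_pow _ (h2 d ^ m)]

theorem IsRep.lift (hf : IsRep m f q) (i : ℕ) : IsRep (m + i) f (q * h2 d ^ i) := by
  unfold IsRep at *
  rw [map_mul, ← hf, pow_add, map_mul]
  ring

theorem IsRep.rep_unique (hf : IsRep m f q) (hf' : IsRep m f r) : q = r :=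
  RatFunc.algebraMap_injective ℝ (hf.symm.trans hf')

theorem IsRep.fun_unique (hP : Irreducible (cubic a d e)) (hf : IsRep m f q)
    (hg : IsRep m g q) : f = g :=
  toRatFunc_injective hP (mul_right_cancel₀ (algebraMap_h2_pow_ne_zero d m) (hf.trans hg.symm))

theorem isRep_cx : IsRep 1 (cx a d e) (num a e) := by
  unfold IsRep
  rw [cx, toRatFunc_mk, pow_one, ← h3_mul_h2, pullback, MvPolynomial.aeval_X]
  rfl

theorem isRep_cy : IsRep 0 (cy a d e) X := by
  unfold IsRep
  rw [cy, toRatFunc_mk, pow_zero, map_one, mul_one, RatFunc.algebraMap_X, pullback,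
    MvPolynomial.aeval_X]
  rfl

theorem isRep_monomial {i j : ℕ} (h : i ≤ m) :
    IsRep m (cx a d e ^ i * cy a d e ^ j) (num a e ^ i * X ^ j * h2 d ^ (m - i)) := by
  have h1 := ((isRep_cx (a := a) (d := d) (e := e)).pow i).mul
    ((isRep_cy (a := a) (d := d) (e := e)).pow j)
  have h2 := h1.lift (m - i)
  rwa [one_mul, zero_mul, add_zero, Nat.add_sub_cancel' h] at h2

theorem natDegree_monomial_le {i j : ℕ} :
    (num a e ^ i * X ^ j * h2 d ^ n).natDegree ≤ i + j + 2 * n := by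
  refine natDegree_mul_le.trans (add_le_add (natDegree_mul_le.trans (add_le_add ?_ ?_)) ?_)
  · exact (natDegree_pow_le_of_le i (natDegree_num_le a e)).trans (by omega)
  · rw [natDegree_X_pow]
  · rw [natDegree_pow, h2_natDegree, mul_comm]

theorem IsRep.eval_eq {p : MvPolynomial (Fin 2) ℝ}
    (hf : IsRep (a := a) (d := d) (e := e) m (Ideal.Quotient.mk _ p) q) {t : ℝ}
    (ht : t ^ 2 ≠ d) :
    MvPolynomial.eval (curvePoint a d e t) p * (t ^ 2 - d) ^ m = q.eval t := by
  obtain ⟨M, N, h, h'⟩ := exists_pullback_eq a d e p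
  have h1 : q * h2 d ^ M = N * h2 d ^ m := by
    apply RatFunc.algebraMap_injective ℝ
    rw [map_mul, map_mul, ← h, ← hf, toRatFunc_mk]
    ring
  have h2 := congrArg (eval t) h1
  rw [eval_mul, eval_mul, eval_pow, eval_pow, eval_h2, ← h' t ht] at h2
  have h0 : (t ^ 2 - d) ^ M ≠ 0 := pow_ne_zero _ (sub_ne_zero.2 ht)
  apply mul_right_cancel₀ h0
  rw [h2]
  ring

end IsRep

/-! ### The spaces `ℝ[C]_{≤ k}` and `V^(k)` in terms of polynomials -/

/-- The functions on the curve of the form `q / (t² - d)^m` with `q ∈ W`. -/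
def repSpace (a d e : ℝ) (m : ℕ) (W : Submodule ℝ ℝ[X]) :
    Submodule ℝ (CoordRing (curve a d e)) where
  carrier := {f | ∃ q ∈ W, IsRep m f q}
  zero_mem' := ⟨0, W.zero_mem, IsRep.zero⟩
  add_mem' := by
    rintro f g ⟨q, hq, hf⟩ ⟨r, hr, hg⟩
    exact ⟨q + r, W.add_mem hq hr, hf.add hg⟩
  smul_mem' := by
    rintro c f ⟨q, hq, hf⟩
    exact ⟨c • q, W.smul_mem c hq, hf.smul c⟩

theorem h2_eq_mul {d δ : ℝ} (hd : δ ^ 2 = d) : h2 d = (X - C δ) * (X - C (-δ)) := by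
  rw [h2, ← hd, map_pow, map_neg]
  ring

theorem exists_eq_h2_mul {d δ : ℝ} (hδ : δ ≠ 0) (hd : δ ^ 2 = d) {q : ℝ[X]}
    (h1 : q.eval δ = 0) (h2' : q.eval (-δ) = 0) {n : ℕ} (hq : q.natDegree ≤ n + 2) :
    ∃ r : ℝ[X], q = r * h2 d ∧ r.natDegree ≤ n := by
  have hdvd : h2 d ∣ q := by
    rw [h2_eq_mul hd]
    refine IsCoprime.mul_dvd ?_ (dvd_iff_isRoot.2 h1) (dvd_iff_isRoot.2 h2')
    refine isCoprime_X_sub_C_of_isUnit_sub (Ne.isUnit ?_)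
    intro h
    apply hδ
    linarith
  obtain ⟨r, hr⟩ := hdvd
  refine ⟨r, by rw [hr, mul_comm], ?_⟩
  by_cases hr0 : r = 0
  · simp [hr0]
  · rw [hr, natDegree_mul (h2_ne_zero d) hr0, h2_natDegree] at hq
    omega

/-! ### Realizing prescribed numerators by functions on the curve -/

section Spaces

variable {a d e δ : ℝ}

/-- Induction on the pole order at ±δ: since `num` does not vanish there, a combination of x^(j+1)
and x^(j+1) y matches q at both points, and the difference is divisible by t² - d. -/
theorem exists_isRep_of_natDegree_le (hP : Irreducible (cubic a d e)) (hδ : δ ≠ 0)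
    (hd : δ ^ 2 = d) {M : Submodule ℝ (CoordRing (curve a d e))} {l : ℕ}
    (hy : ∀ i ≤ l, cy a d e ^ i ∈ M) (j : ℕ)
    (hx : ∀ i, 1 ≤ i → i ≤ j → cx a d e ^ i ∈ M ∧ cx a d e ^ i * cy a d e ∈ M) (q : ℝ[X])
    (hq : q.natDegree ≤ 2 * j + l) : ∃ f ∈ M, IsRep j f q := by
  induction j generalizing q with
  | zero =>
    refine ⟨aeval (cy a d e) q, ?_, ?_⟩
    · rw [aeval_eq_sum_range]
      refine M.sum_mem fun i hi => M.smul_mem _ (hy i ?_)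
      have := Finset.mem_range.1 hi
      omega
    · have hX := isRep_cy (a := a) (d := d) (e := e)
      unfold IsRep at *
      rw [pow_zero, map_one, mul_one] at *
      rw [← aeval_algHom_apply, hX, aeval_algebraMap_apply, aeval_X_left, AlgHom.id_apply]
  | succ j ih =>
    have h1 := pow_ne_zero (j + 1) (eval_num_ne_zero hP hd)
    have h2' := pow_ne_zero (j + 1) (eval_num_ne_zero hP ((neg_sq δ).trans hd))
    set x := q.eval δ / (num a e).eval δ ^ (j + 1) with hxdef
    set y := q.eval (-δ) / (num a e).eval (-δ) ^ (j + 1) with hydef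
    have hrep : IsRep (j + 1) (((x + y) / 2) • cx a d e ^ (j + 1) +
        ((x - y) / (2 * δ)) • (cx a d e ^ (j + 1) * cy a d e))
        (lineThrough δ x y * num a e ^ (j + 1)) := by
      have h3 := (isRep_cx (a := a) (d := d) (e := e)).pow (j + 1)
      rw [one_mul] at h3
      have h4 := (h3.smul ((x + y) / 2)).add
        ((h3.mul (isRep_cy (a := a) (d := d) (e := e))).smul ((x - y) / (2 * δ)))
      convert h4 using 1
      rw [lineThrough, Polynomial.smul_eq_C_mul, Polynomial.smul_eq_C_mul]
      ring
    obtain ⟨r, hr, hrd⟩ := exists_eq_h2_mul (q := q - lineThrough δ x y * num a e ^ (j + 1))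
      (n := 2 * j + l) hδ hd
      (by rw [eval_sub, eval_mul, eval_lineThrough hδ, eval_pow, hxdef, div_mul_cancel₀ _ h1,
        sub_self])
      (by rw [eval_sub, eval_mul, eval_lineThrough_neg hδ, eval_pow, hydef, div_mul_cancel₀ _ h2',
        sub_self])
      (by
        have h5 := natDegree_lineThrough_le δ x y
        have h6 := natDegree_pow_le_of_le (j + 1) (natDegree_num_le a e)
        refine (natDegree_sub_le _ _).trans (max_le (by omega) (natDegree_mul_le.trans ?_))
        omega)
    obtain ⟨f, hf, hfr⟩ := ih (fun i h1 h2 => hx i h1 (by omega)) r hrd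
    have h7 := hfr.lift 1
    rw [pow_one, ← hr] at h7
    refine ⟨_, M.add_mem hf (M.add_mem (M.smul_mem ((x + y) / 2) (hx (j + 1) (by omega) le_rfl).1)
      (M.smul_mem ((x - y) / (2 * δ)) (hx (j + 1) (by omega) le_rfl).2)), ?_⟩
    have h8 := h7.add hrep
    rwa [sub_add_cancel] at h8

/-- In the top pole order k only one function g is available. Proportionality of the values at ±δ is
exactly what lets a multiple of g cancel both leading poles at once. -/
theorem exists_isRep_of_mem_nodeSpace (hP : Irreducible (cubic a d e)) (hδ : δ ≠ 0)
    (hd : δ ^ 2 = d) {M : Submodule ℝ (CoordRing (curve a d e))} {k l N : ℕ} (hk : 1 ≤ k)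
    (hy : ∀ i ≤ l, cy a d e ^ i ∈ M)
    (hx : ∀ i, 1 ≤ i → i < k → cx a d e ^ i ∈ M ∧ cx a d e ^ i * cy a d e ∈ M)
    {u v : ℝ} (hu : u ≠ 0) {g : CoordRing (curve a d e)} (hg : g ∈ M) {q₀ : ℝ[X]}
    (hg₀ : IsRep k g q₀) (hq₀ : q₀ ∈ nodeSpace δ u v (2 * k + l)) (hne : q₀.eval δ ≠ 0)
    {q : ℝ[X]} (hq : q ∈ nodeSpace δ u v N) (hqd : q.natDegree ≤ 2 * k + l) :
    ∃ f ∈ M, IsRep k f q := by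
  obtain ⟨j, rfl⟩ := Nat.exists_eq_add_of_le' hk
  set c := q.eval δ / q₀.eval δ with hc
  obtain ⟨r, hr, hrd⟩ := exists_eq_h2_mul (q := q - c • q₀) (n := 2 * j + l) hδ hd
    (by rw [eval_sub, eval_smul, smul_eq_mul, hc, div_mul_cancel₀ _ hne, sub_self])
    (by
      have h1 := hq.2
      have h2 := hq₀.2
      rw [eval_sub, eval_smul, smul_eq_mul, hc]
      apply mul_right_cancel₀ hu
      rw [zero_mul, sub_mul, ← h1, mul_assoc, ← h2]
      field_simp
      ring)
    (by
      refine (natDegree_sub_le _ _).trans (max_le (by omega)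
        ((natDegree_smul_le _ _).trans (hq₀.1.trans (by omega)))))
  obtain ⟨f, hf, hfr⟩ := exists_isRep_of_natDegree_le hP hδ hd hy j
    (fun i h1 h2 => hx i h1 (by omega)) r hrd
  have h7 := hfr.lift 1
  rw [pow_one, ← hr] at h7
  refine ⟨_, M.add_mem hf (M.smul_mem c hg), ?_⟩
  have h8 := h7.add (hg₀.smul c)
  rwa [sub_add_cancel] at h8

end Spaces

/-! ### The spans of the given generators as spaces of numerators -/

section Bases

variable {a d e δ : ℝ} {k : ℕ}

/-- For i < k a factor t² - d survives, so the numerator vanishes at ±δ and the ratio u : v is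
irrelevant. -/
theorem monomial_mem_nodeSpace (hd : δ ^ 2 = d) {i j N : ℕ} (hi : i < k)
    (hN : i + j + 2 * (k - i) ≤ N) (u v : ℝ) :
    num a e ^ i * X ^ j * h2 d ^ (k - i) ∈ nodeSpace δ u v N := by
  refine ⟨natDegree_monomial_le.trans hN, ?_⟩
  have h0 : k - i ≠ 0 := by omega
  simp [eval_h2, hd, h0]

/-- The generators `x^j`, `x^j y` with `1 ≤ j < k`, the powers `y^l` with `l ≤ k`, and one more
function `g`. -/
def generatorsWith (a d e : ℝ) (k : ℕ) (g : CoordRing (curve a d e)) :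
    Set (CoordRing (curve a d e)) :=
  {g} ∪ {f | ∃ j, 1 ≤ j ∧ j < k ∧ (f = cx a d e ^ j ∨ f = cx a d e ^ j * cy a d e)} ∪
    {f | ∃ l, l ≤ k ∧ f = cy a d e ^ l}

theorem cy_pow_isRep (l : ℕ) (u v : ℝ) (hk : 1 ≤ k) (hd : δ ^ 2 = d) :
    ∃ q ∈ nodeSpace δ u v (2 * k + l), IsRep k (cy a d e ^ l) q := by
  refine ⟨_, monomial_mem_nodeSpace (a := a) (e := e) (k := k) hd (i := 0) (j := l) (by omega)
    (by omega) u v, ?_⟩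
  have := isRep_monomial (a := a) (d := d) (e := e) (m := k) (i := 0) (j := l) (by omega)
  rwa [pow_zero, one_mul] at this

theorem nodeSpace_mono {u v : ℝ} {m n : ℕ} (h : m ≤ n) : nodeSpace δ u v m ≤ nodeSpace δ u v n :=
  fun _ hq => ⟨hq.1.trans h, hq.2⟩

theorem generator_cases (hk : 1 ≤ k) (hd : δ ^ 2 = d) {u v : ℝ}
    {g : CoordRing (curve a d e)} (hg : g ∈ repSpace a d e k (nodeSpace δ u v (3 * k - 1)))
    {f : CoordRing (curve a d e)} (hf : f ∈ generatorsWith a d e k g) :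
    f = cy a d e ^ k ∨ f ∈ repSpace a d e k (nodeSpace δ u v (3 * k - 1)) := by
  rcases hf with (rfl | ⟨j, h1, h2, rfl | rfl⟩) | ⟨l, h1, rfl⟩
  · exact Or.inr hg
  · refine Or.inr ⟨_, monomial_mem_nodeSpace (a := a) (e := e) hd (j := 0) h2 (by omega) u v, ?_⟩
    simpa using isRep_monomial (a := a) (d := d) (e := e) (m := k) (i := j) (j := 0) h2.le
  · refine Or.inr ⟨_, monomial_mem_nodeSpace (a := a) (e := e) hd (j := 1) h2 (by omega) u v, ?_⟩
    simpa using isRep_monomial (a := a) (d := d) (e := e) (m := k) (i := j) (j := 1) h2.le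
  · rcases h1.eq_or_lt with rfl | h1
    · exact Or.inl rfl
    · obtain ⟨q, hq, hqr⟩ := cy_pow_isRep (a := a) (e := e) l u v hk hd
      exact Or.inr ⟨q, nodeSpace_mono (by omega) hq, hqr⟩

/-- Over (t² - d)^k the numerator of y^k is the monic polynomial t^k (t² - d)^k, of degree exactly 3
k. -/
theorem cy_pow_notMem (hk : 1 ≤ k) (u v : ℝ) :
    cy a d e ^ k ∉ repSpace a d e k (nodeSpace δ u v (3 * k - 1)) := by
  rintro ⟨q, hq, hqr⟩
  have h1 := ((isRep_cy (a := a) (d := d) (e := e)).pow k).lift k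
  rw [zero_mul, zero_add] at h1
  have h2 := hq.1
  rw [hqr.rep_unique h1, (monic_X_pow k).natDegree_mul ((h2_monic d).pow k), natDegree_X_pow,
    natDegree_pow, h2_natDegree] at h2
  omega

theorem repSpace_le_span (hP : Irreducible (cubic a d e)) (hδ : δ ≠ 0) (hd : δ ^ 2 = d)
    (hk : 1 ≤ k) {u v : ℝ} (hu : u ≠ 0) {g : CoordRing (curve a d e)} {q₀ : ℝ[X]}
    (hg : IsRep k g q₀) (hq₀ : q₀ ∈ nodeSpace δ u v (3 * k - 1)) (hne : q₀.eval δ ≠ 0) {l : ℕ}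
    (hl : k ≤ l + 1) {M : Submodule ℝ (CoordRing (curve a d e))} (hgM : g ∈ M)
    (hy : ∀ i ≤ l, cy a d e ^ i ∈ M)
    (hx : ∀ i, 1 ≤ i → i < k → cx a d e ^ i ∈ M ∧ cx a d e ^ i * cy a d e ∈ M) :
    repSpace a d e k (nodeSpace δ u v (2 * k + l)) ≤ M := by
  rintro f ⟨q, hq, hf⟩
  obtain ⟨f', hf', hr⟩ := exists_isRep_of_mem_nodeSpace hP hδ hd hk hy hx hu hgM hg
    (nodeSpace_mono (by omega) hq₀) hne hq hq.1
  rwa [hf.fun_unique hP hr]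

theorem span_generatorsWith (hP : Irreducible (cubic a d e)) (hδ : δ ≠ 0) (hd : δ ^ 2 = d)
    (hk : 1 ≤ k) {u v : ℝ} (hu : u ≠ 0) {g : CoordRing (curve a d e)} {q₀ : ℝ[X]}
    (hg : IsRep k g q₀) (hq₀ : q₀ ∈ nodeSpace δ u v (3 * k - 1)) (hne : q₀.eval δ ≠ 0) :
    Submodule.span ℝ (generatorsWith a d e k g) = repSpace a d e k (nodeSpace δ u v (3 * k)) := by
  apply le_antisymm
  · rw [Submodule.span_le]
    intro f hf
    rcases generator_cases hk hd ⟨q₀, hq₀, hg⟩ hf with rfl | ⟨q, hq, hr⟩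
    · obtain ⟨q, hq, hr⟩ := cy_pow_isRep (a := a) (e := e) k u v hk hd
      exact ⟨q, nodeSpace_mono (by omega) hq, hr⟩
    · exact ⟨q, nodeSpace_mono (by omega) hq, hr⟩
  · rw [show 3 * k = 2 * k + k by ring]
    exact repSpace_le_span hP hδ hd hk hu hg hq₀ hne (by omega)
      (Submodule.subset_span (Or.inl (Or.inl rfl)))
      (fun i hi => Submodule.subset_span (Or.inr ⟨i, hi, rfl⟩))
      fun i h1 h2 => ⟨Submodule.subset_span (Or.inl (Or.inr ⟨i, h1, h2, Or.inl rfl⟩)),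
        Submodule.subset_span (Or.inl (Or.inr ⟨i, h1, h2, Or.inr rfl⟩))⟩

/-- Only y^k has a numerator of degree 3 k, so deleting it lowers the degree bound by one and
changes nothing else. -/
theorem span_generatorsWith_diff (hP : Irreducible (cubic a d e)) (hδ : δ ≠ 0) (hd : δ ^ 2 = d)
    (hk : 1 ≤ k) {u v : ℝ} (hu : u ≠ 0) {g : CoordRing (curve a d e)} {q₀ : ℝ[X]}
    (hg : IsRep k g q₀) (hq₀ : q₀ ∈ nodeSpace δ u v (3 * k - 1)) (hne : q₀.eval δ ≠ 0) :
    Submodule.span ℝ (generatorsWith a d e k g \ {cy a d e ^ k}) =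
      repSpace a d e k (nodeSpace δ u v (3 * k - 1)) := by
  have hgS : g ∈ repSpace a d e k (nodeSpace δ u v (3 * k - 1)) := ⟨q₀, hq₀, hg⟩
  apply le_antisymm
  · rw [Submodule.span_le]
    rintro f ⟨hf, hf'⟩
    exact (generator_cases hk hd hgS hf).resolve_left hf'
  · have hmem : ∀ f ∈ generatorsWith a d e k g,
        f ∈ repSpace a d e k (nodeSpace δ u v (3 * k - 1)) →
        f ∈ Submodule.span ℝ (generatorsWith a d e k g \ {cy a d e ^ k}) := fun f hf hf' =>
      Submodule.subset_span ⟨hf, fun h => cy_pow_notMem hk u v (by rwa [h] at hf')⟩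
    rw [show 3 * k - 1 = 2 * k + (k - 1) by omega] at *
    refine repSpace_le_span hP hδ hd hk hu hg (by
        rwa [show 3 * k - 1 = 2 * k + (k - 1) by omega]) hne (by omega)
      (hmem _ (Or.inl (Or.inl rfl)) hgS) (fun i hi => hmem _ (Or.inr ⟨i, by omega, rfl⟩) ?_)
      fun i h1 h2 => ⟨hmem _ (Or.inl (Or.inr ⟨i, h1, h2, Or.inl rfl⟩)) ?_,
        hmem _ (Or.inl (Or.inr ⟨i, h1, h2, Or.inr rfl⟩)) ?_⟩
    · obtain ⟨q, hq, hr⟩ := cy_pow_isRep (a := a) (e := e) (k := k) i u v hk hd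
      exact ⟨q, nodeSpace_mono (by omega) hq, hr⟩
    · refine ⟨_, monomial_mem_nodeSpace (a := a) (e := e) hd (j := 0) h2 (by omega) u v, ?_⟩
      simpa using isRep_monomial (a := a) (d := d) (e := e) (m := k) (i := i) (j := 0) h2.le
    · refine ⟨_, monomial_mem_nodeSpace (a := a) (e := e) hd (j := 1) h2 (by omega) u v, ?_⟩
      simpa using isRep_monomial (a := a) (d := d) (e := e) (m := k) (i := i) (j := 1) h2.le

theorem cx_pow_isRep (k : ℕ) : IsRep k (cx a d e ^ k) (num a e ^ k) := by
  have := (isRep_cx (a := a) (d := d) (e := e)).pow k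
  rwa [one_mul] at this

theorem num_pow_mem_nodeSpace (hk : 1 ≤ k) : num a e ^ k ∈
    nodeSpace δ ((num a e).eval δ ^ k) ((num a e).eval (-δ) ^ k) (3 * k - 1) := by
  refine ⟨(natDegree_pow_le_of_le k (natDegree_num_le a e)).trans (by omega), ?_⟩
  rw [eval_pow, eval_pow, mul_comm]

/-- The extra factor t takes the values δ and -δ; this is the source of the sign that distinguishes
V^(k) from ℝ[C]_{≤ k}. -/
theorem num_pow_mul_X_mem_nodeSpace (hk : 1 ≤ k) : num a e ^ k * X ∈
    nodeSpace δ ((num a e).eval δ ^ k) (-(num a e).eval (-δ) ^ k) (3 * k - 1) := by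
  refine ⟨natDegree_mul_le.trans ?_, ?_⟩
  · have := natDegree_pow_le_of_le k (natDegree_num_le a e)
    rw [natDegree_X]
    omega
  · rw [eval_mul, eval_mul, eval_pow, eval_pow, eval_X, eval_X]
    ring

theorem cx_pow_mul_cy_isRep (k : ℕ) : IsRep k (cx a d e ^ k * cy a d e) (num a e ^ k * X) :=
  (cx_pow_isRep k).mul isRep_cy

theorem mk_monomial (s : Fin 2 →₀ ℕ) (c : ℝ) :
    (Ideal.Quotient.mk (MvPolynomial.vanishingIdeal ℝ (curve a d e)) (MvPolynomial.monomial s c)) =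
      c • (cx a d e ^ s 0 * cy a d e ^ s 1) := by
  rw [MvPolynomial.monomial_eq, Finsupp.prod_fintype _ _ fun _ => pow_zero _, Fin.prod_univ_two,
    map_mul, map_mul, map_pow, map_pow]
  exact (Algebra.smul_def (A := CoordRing (curve a d e)) c _).symm

theorem coordDeg_le_repSpace (hd : δ ^ 2 = d) (hk : 1 ≤ k) :
    coordDeg (curve a d e) k ≤ repSpace a d e k
      (nodeSpace δ ((num a e).eval δ ^ k) ((num a e).eval (-δ) ^ k) (3 * k)) := by
  intro f hf
  obtain ⟨p, hp, rfl⟩ := mem_coordDeg _ hf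
  rw [p.as_sum, map_sum]
  refine Submodule.sum_mem _ fun s hs => ?_
  rw [mk_monomial]
  refine Submodule.smul_mem _ _ ?_
  have hs' : s 0 + s 1 ≤ k := by
    have := (MvPolynomial.le_totalDegree hs).trans hp
    rwa [Finsupp.sum_fintype _ _ (fun _ => rfl), Fin.sum_univ_two] at this
  rcases Nat.lt_or_ge (s 0) k with h | h
  · exact ⟨_, monomial_mem_nodeSpace hd h (by omega) _ _, isRep_monomial h.le⟩
  · rw [show s 0 = k by omega, show s 1 = 0 by omega, pow_zero, mul_one]
    exact ⟨_, nodeSpace_mono (by omega) (num_pow_mem_nodeSpace hk), cx_pow_isRep k⟩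

theorem coordDeg_eq_repSpace (hP : Irreducible (cubic a d e)) (hδ : δ ≠ 0) (hd : δ ^ 2 = d)
    (hk : 1 ≤ k) : coordDeg (curve a d e) k = repSpace a d e k
      (nodeSpace δ ((num a e).eval δ ^ k) ((num a e).eval (-δ) ^ k) (3 * k)) := by
  refine le_antisymm (coordDeg_le_repSpace hd hk) ?_
  rw [show 3 * k = 2 * k + k by ring]
  have hm : ∀ {i j : ℕ}, i + j ≤ k → cx a d e ^ i * cy a d e ^ j ∈ coordDeg (curve a d e) k :=
    fun h => monomial_mem a d e h
  refine repSpace_le_span hP hδ hd hk (pow_ne_zero k (eval_num_ne_zero hP hd)) (cx_pow_isRep k)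
    (num_pow_mem_nodeSpace hk) ?_ (by omega) ?_ (fun i hi => ?_) fun i h1 h2 => ⟨?_, ?_⟩
  · rw [eval_pow]
    exact pow_ne_zero k (eval_num_ne_zero hP hd)
  · simpa using hm (i := k) (j := 0) (by omega)
  · simpa using hm (i := 0) (j := i) (by omega)
  · simpa using hm (i := i) (j := 0) (by omega)
  · simpa using hm (i := i) (j := 1) (by omega)

/-- `basisB` unfolds to `generatorsWith` with g = x^k; likewise `basisBt` with g = x^k y. -/
theorem span_basisB_diff (hP : Irreducible (cubic a d e)) (hδ : δ ≠ 0) (hd : δ ^ 2 = d)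
    (hk : 1 ≤ k) : Submodule.span ℝ (basisB a d e k \ {cy a d e ^ k}) = repSpace a d e k
      (nodeSpace δ ((num a e).eval δ ^ k) ((num a e).eval (-δ) ^ k) (3 * k - 1)) :=
  have hu := pow_ne_zero k (eval_num_ne_zero hP hd)
  span_generatorsWith_diff hP hδ hd hk hu (cx_pow_isRep k) (num_pow_mem_nodeSpace hk)
    (by rwa [eval_pow])

theorem spaceV_eq_repSpace (hP : Irreducible (cubic a d e)) (hδ : δ ≠ 0) (hd : δ ^ 2 = d)
    (hk : 1 ≤ k) : spaceV a d e k = repSpace a d e k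
      (nodeSpace δ ((num a e).eval δ ^ k) (-(num a e).eval (-δ) ^ k) (3 * k)) :=
  have hu := pow_ne_zero k (eval_num_ne_zero hP hd)
  span_generatorsWith hP hδ hd hk hu (cx_pow_mul_cy_isRep k) (num_pow_mul_X_mem_nodeSpace hk)
    (by rw [eval_mul, eval_pow, eval_X]; exact mul_ne_zero hu hδ)

theorem span_basisBt_diff (hP : Irreducible (cubic a d e)) (hδ : δ ≠ 0) (hd : δ ^ 2 = d)
    (hk : 1 ≤ k) : Submodule.span ℝ (basisBt a d e k \ {cy a d e ^ k}) = repSpace a d e k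
      (nodeSpace δ ((num a e).eval δ ^ k) (-(num a e).eval (-δ) ^ k) (3 * k - 1)) :=
  have hu := pow_ne_zero k (eval_num_ne_zero hP hd)
  span_generatorsWith_diff hP hδ hd hk hu (cx_pow_mul_cy_isRep k) (num_pow_mul_X_mem_nodeSpace hk)
    (by rw [eval_mul, eval_pow, eval_X]; exact mul_ne_zero hu hδ)

theorem exists_isRep_coord (hP : Irreducible (cubic a d e)) (hδ : δ ≠ 0) (hd : δ ^ 2 = d)
    (hk : 1 ≤ k) {q : ℝ[X]}
    (hq : q ∈ nodeSpace δ ((num a e).eval δ ^ k) ((num a e).eval (-δ) ^ k) (3 * k)) :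
    ∃ f : CoordRing (curve a d e), IsRep k f q := by
  obtain ⟨f, -, hf⟩ := exists_isRep_of_mem_nodeSpace (M := ⊤) (l := k) hP hδ hd hk
    (fun _ _ => trivial) (fun _ _ _ => ⟨trivial, trivial⟩)
    (pow_ne_zero k (eval_num_ne_zero hP hd)) trivial (cx_pow_isRep k)
    (nodeSpace_mono (by omega) (num_pow_mem_nodeSpace hk))
    (by rw [eval_pow]; exact pow_ne_zero k (eval_num_ne_zero hP hd)) hq (hq.1.trans (by omega))
  exact ⟨f, hf⟩

theorem exists_isRep_local (hP : Irreducible (cubic a d e)) (hδ : δ ≠ 0) (hd : δ ^ 2 = d)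
    (hk : 1 ≤ k) {q : ℝ[X]}
    (hq : q ∈ nodeSpace δ ((num a e).eval δ ^ k) (-(num a e).eval (-δ) ^ k) (3 * k)) :
    ∃ f : CoordRing (curve a d e), IsRep k f q := by
  have hu := pow_ne_zero k (eval_num_ne_zero hP hd)
  obtain ⟨f, -, hf⟩ := exists_isRep_of_mem_nodeSpace (M := ⊤) (l := k) hP hδ hd hk
    (fun _ _ => trivial) (fun _ _ _ => ⟨trivial, trivial⟩) hu trivial (cx_pow_mul_cy_isRep k)
    (nodeSpace_mono (by omega) (num_pow_mul_X_mem_nodeSpace hk))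
    (by rw [eval_mul, eval_pow, eval_X]; exact mul_ne_zero hu hδ) hq (hq.1.trans (by omega))
  exact ⟨f, hf⟩

end Bases

/-! ### Functionals on the curve as functionals on univariate polynomials -/

/-- `l` is the functional `q ↦ L (q / (t² - d)^(2k))`, where the latter is defined. -/
def Represents (a d e : ℝ) {k : ℕ} (L : polyDeg (2 * k) →ₗ[ℝ] ℝ) (l : ℝ[X] →ₗ[ℝ] ℝ) : Prop :=
  ∀ (p : polyDeg (2 * k)) (Q : ℝ[X]),
    IsRep (a := a) (d := d) (e := e) (2 * k) (Ideal.Quotient.mk _ (p : MvPolynomial (Fin 2) ℝ)) Q →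
      l Q = L p

section Functionals

variable {a d e δ : ℝ} {k : ℕ} {L : polyDeg (2 * k) →ₗ[ℝ] ℝ} {l : ℝ[X] →ₗ[ℝ] ℝ}
  {Lhat : rrSpace d (2 * k) →ₗ[ℝ] ℝ}

theorem isRep_iff_eq_div {m : ℕ} {f : CoordRing (curve a d e)} {q : ℝ[X]} :
    IsRep m f q ↔ toRatFunc a d e f =
      algebraMap ℝ[X] (RatFunc ℝ) q / algebraMap ℝ[X] (RatFunc ℝ) (h2 d ^ m) :=
  (eq_div_iff (algebraMap_h2_pow_ne_zero d m)).symm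

theorem exists_isRep_polyDeg {m : ℕ} (p : polyDeg m) : ∃ q : ℝ[X], q.natDegree ≤ 3 * m ∧
    IsRep (a := a) (d := d) (e := e) m (Ideal.Quotient.mk _ (p : MvPolynomial (Fin 2) ℝ)) q := by
  obtain ⟨q, hq, h⟩ := (mem_rrSpace d m _).1 (pullback_mem a d e p)
  exact ⟨q, hq, isRep_iff_eq_div.2 h⟩

theorem inducedFunctional_eq (hl : Represents a d e L l) (hL : VanishesOnIdeal (curve a d e) L)
    (F : coordDeg (curve a d e) (2 * k)) {Q : ℝ[X]}
    (hQ : IsRep (2 * k) (F : CoordRing (curve a d e)) Q) :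
    inducedFunctional (curve a d e) L hL F = l Q := by
  obtain ⟨F, p, rfl⟩ := F
  rw [inducedFunctional_apply]
  exact (hl p Q hQ).symm

theorem mem_uniDeg {m : ℕ} {q : ℝ[X]} : q ∈ uniDeg m ↔ q.natDegree ≤ m := by
  rw [Polynomial.mem_degreeLE, Polynomial.natDegree_le_iff_degree_le]

/-- Functionals on all of ℝ[t] are easier to handle than those on degree subspaces; the values
beyond degree 6 k are arbitrary and never matter. -/
theorem exists_extend_uniFunctional (Lhat : rrSpace d (2 * k) →ₗ[ℝ] ℝ) :
    ∃ l : ℝ[X] →ₗ[ℝ] ℝ, ∀ Q : uniDeg (6 * k), uniFunctional d Lhat Q = l Q := by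
  obtain ⟨l, hl⟩ := LinearMap.exists_extend (uniFunctional d Lhat)
  exact ⟨l, fun Q => by rw [← hl]; rfl⟩

theorem divMap_bijective (d : ℝ) (k : ℕ) : Function.Bijective (divMap d k) := by
  constructor
  · intro p q h
    have h1 := congrArg Subtype.val h
    have h2 := (div_left_inj' (algebraMap_h2_pow_ne_zero d (2 * k))).1 h1
    exact Subtype.ext (RatFunc.algebraMap_injective ℝ h2)
  · rintro ⟨f, hf⟩
    obtain ⟨q, hq, rfl⟩ := (mem_rrSpace d _ _).1 hf
    exact ⟨⟨q, mem_uniDeg.2 (by omega)⟩, rfl⟩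

theorem exists_uniFunctional_eq (d : ℝ) (k : ℕ) (l : ℝ[X] →ₗ[ℝ] ℝ) :
    ∃ Lhat : rrSpace d (2 * k) →ₗ[ℝ] ℝ, ∀ Q : uniDeg (6 * k), uniFunctional d Lhat Q = l Q := by
  let E := LinearEquiv.ofBijective (divMap d k) (divMap_bijective d k)
  refine ⟨(l.domRestrict (uniDeg (6 * k))) ∘ₗ E.symm.toLinearMap, fun Q => ?_⟩
  have : E.symm (divMap d k Q) = Q := E.symm_apply_apply Q
  change l.domRestrict _ (E.symm (divMap d k Q)) = _
  rw [this]
  rfl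

theorem isExtension_iff (hl : ∀ Q : uniDeg (6 * k), uniFunctional d Lhat Q = l Q) :
    IsExtension a d e L Lhat ↔ Represents a d e L l := by
  have key : ∀ (p : polyDeg (2 * k)) (Q : ℝ[X]), IsRep (a := a) (d := d) (e := e) (2 * k)
      (Ideal.Quotient.mk _ (p : MvPolynomial (Fin 2) ℝ)) Q →
      Lhat ⟨pullback a d e p, pullback_mem a d e p⟩ = l Q := by
    intro p Q hQ
    obtain ⟨q, hq, hr⟩ := exists_isRep_polyDeg (a := a) (d := d) (e := e) p
    obtain rfl := hr.rep_unique hQ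
    rw [← hl ⟨q, mem_uniDeg.2 (by omega)⟩]
    exact congrArg Lhat (Subtype.ext (isRep_iff_eq_div.1 hQ))
  constructor
  · intro h p Q hQ
    rw [← key p Q hQ, h p]
  · intro h p
    obtain ⟨q, -, hr⟩ := exists_isRep_polyDeg (a := a) (d := d) (e := e) p
    rw [key p q hr, h p q hr]

/-- L kills the kernel of the pullback, so it factors through the pullback as a functional on 𝓛(2k
D), with no positivity claimed. -/
theorem exists_represents (hP : Irreducible (cubic a d e))
    (hL : VanishesOnIdeal (curve a d e) L) : ∃ l, Represents a d e L l := by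
  let T : polyDeg (2 * k) →ₗ[ℝ] rrSpace d (2 * k) :=
    ((pullback a d e).toLinearMap ∘ₗ (polyDeg (2 * k)).subtype).codRestrict _
      fun p => pullback_mem a d e p
  have h1 : L ∈ (LinearMap.ker T).dualAnnihilator := by
    rw [Submodule.mem_dualAnnihilator]
    intro p hp
    refine hL p (Ideal.Quotient.eq_zero_iff_mem.1 (toRatFunc_injective hP ?_))
    rw [map_zero]
    exact congrArg Subtype.val (LinearMap.mem_ker.1 hp)
  rw [← LinearMap.range_dualMap_eq_dualAnnihilator_ker] at h1
  obtain ⟨Lhat, h⟩ := h1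
  obtain ⟨l, hl⟩ := exists_extend_uniFunctional Lhat
  exact ⟨l, (isExtension_iff hl).1 fun p => LinearMap.congr_fun h p⟩

theorem isPos_rrForm_iff (hl : ∀ Q : uniDeg (6 * k), uniFunctional d Lhat Q = l Q) :
    IsPos (rrForm d Lhat) ↔ ∀ q : ℝ[X], q.natDegree ≤ 3 * k → 0 ≤ l (q * q) := by
  have key : ∀ (f : rrSpace d k) (q : ℝ[X]), q.natDegree ≤ 3 * k →
      (f : RatFunc ℝ) = algebraMap _ _ q / algebraMap _ _ (h2 d ^ k) →
      rrForm d Lhat f f = l (q * q) := by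
    intro f q hq hf
    have hqq : q * q ∈ uniDeg (6 * k) := mem_uniDeg.2 (natDegree_mul_le.trans (by omega))
    rw [← hl ⟨q * q, hqq⟩]
    refine congrArg Lhat (Subtype.ext ?_)
    change (f : RatFunc ℝ) * f = algebraMap _ _ (q * q) / algebraMap _ _ (h2 d ^ (2 * k))
    rw [hf, div_mul_div_comm, ← map_mul, ← map_mul, ← pow_add, two_mul]
  constructor
  · intro h q hq
    rw [← key ⟨_, (mem_rrSpace d k _).2 ⟨q, hq, rfl⟩⟩ q hq rfl]
    exact h _
  · rintro h f
    obtain ⟨q, hq, hf⟩ := (mem_rrSpace d k _).1 f.2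
    rw [key f q hq hf]
    exact h q hq

theorem mem_ker_uniForm_iff {l' : uniDeg (6 * k) →ₗ[ℝ] ℝ} (hl : ∀ Q : uniDeg (6 * k), l' Q = l Q)
    (p : uniDeg (3 * k)) :
    p ∈ LinearMap.ker (uniForm l') ↔ InKernel l (3 * k) (p : ℝ[X]) := by
  constructor
  · intro h
    refine ⟨mem_uniDeg.1 p.2, fun r hr => ?_⟩
    have h1 := LinearMap.congr_fun (LinearMap.mem_ker.1 h) ⟨r, mem_uniDeg.2 hr⟩
    rw [← hl ⟨p * r, uniDeg_mul k _ p.2 _ (mem_uniDeg.2 hr)⟩]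
    exact h1
  · intro h
    refine LinearMap.mem_ker.2 (LinearMap.ext fun r => ?_)
    exact (hl _).trans (h.2 r (mem_uniDeg.1 r.2))

theorem generatingNonvanishing_iff {l' : uniDeg (6 * k) →ₗ[ℝ] ℝ}
    (hl : ∀ Q : uniDeg (6 * k), l' Q = l Q) :
    GeneratingNonvanishing d l' ↔ ∃ p : ℝ[X], IsMinimalKernel l (3 * k) p ∧
      p.eval (Real.sqrt d) ≠ 0 ∧ p.eval (-Real.sqrt d) ≠ 0 := by
  constructor
  · rintro ⟨p, ⟨h1, h2, h3⟩, h4⟩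
    refine ⟨p, ⟨(mem_ker_uniForm_iff hl p).1 h1, fun h => h2 (Subtype.ext h),
      fun q hq hq0 => ?_⟩, h4⟩
    exact h3 ⟨q, mem_uniDeg.2 hq.1⟩ ((mem_ker_uniForm_iff hl _).2 hq)
      fun h => hq0 (congrArg Subtype.val h)
  · rintro ⟨p, ⟨h1, h2, h3⟩, h4⟩
    refine ⟨⟨p, mem_uniDeg.2 h1.1⟩, ⟨(mem_ker_uniForm_iff hl _).2 h1,
      fun h => h2 (congrArg Subtype.val h), fun q hq hq0 => ?_⟩, h4⟩
    exact h3 q ((mem_ker_uniForm_iff hl q).1 hq) fun h => hq0 (Subtype.ext h)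

end Functionals

/-! ### Forms on spaces of functions on the curve -/

section Forms

variable {a d e δ u v : ℝ} {k n : ℕ} {l : ℝ[X] →ₗ[ℝ] ℝ}
  {W : Submodule ℝ (CoordRing (curve a d e))} {B : LinearMap.BilinForm ℝ W}

theorem isPos_iff_of_isRep (hW : W = repSpace a d e k (nodeSpace δ u v n))
    (hB : ∀ (f g : W) (q r : ℝ[X]), IsRep k (f : CoordRing (curve a d e)) q →
      IsRep k (g : CoordRing (curve a d e)) r → B f g = l (q * r))
    (hsurj : ∀ q ∈ nodeSpace δ u v n, ∃ f : CoordRing (curve a d e), IsRep k f q) :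
    IsPos B ↔ ∀ q ∈ nodeSpace δ u v n, 0 ≤ l (q * q) := by
  subst hW
  constructor
  · intro h q hq
    obtain ⟨f, hf⟩ := hsurj q hq
    rw [← hB ⟨f, q, hq, hf⟩ ⟨f, q, hq, hf⟩ q q hf hf]
    exact h _
  · intro h f
    obtain ⟨q, hq, hf⟩ := f.2
    rw [hB f f q q hf hf]
    exact h q hq

theorem finiteDimensional_repSpace (hP : Irreducible (cubic a d e)) (k n : ℕ) :
    FiniteDimensional ℝ (repSpace a d e k (nodeSpace δ u v n)) := by
  have : FiniteDimensional ℝ (nodeSpace δ u v n) :=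
    finiteDimensional_of_natDegree_le fun q hq => hq.1
  choose rep hrep using fun f : repSpace a d e k (nodeSpace δ u v n) => f.2
  let T : repSpace a d e k (nodeSpace δ u v n) →ₗ[ℝ] nodeSpace δ u v n :=
    { toFun := fun f => ⟨rep f, (hrep f).1⟩
      map_add' := fun f g => Subtype.ext
        ((hrep (f + g)).2.rep_unique ((hrep f).2.add (hrep g).2))
      map_smul' := fun c f => Subtype.ext ((hrep (c • f)).2.rep_unique ((hrep f).2.smul c)) }
  refine FiniteDimensional.of_injective T fun f g h => Subtype.ext ?_
  have h1 : rep f = rep g := congrArg Subtype.val h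
  exact (hrep f).2.fun_unique hP (by rw [h1]; exact (hrep g).2)

/-- The smaller space is the hyperplane where the coefficient of t^(3k) in the numerator vanishes,
so the ranks agree iff some kernel element has that coefficient nonzero. -/
theorem formRank_eq_iff_of_isRep (hP : Irreducible (cubic a d e)) (hd : δ ^ 2 = d) (hk : 1 ≤ k)
    (hW : W = repSpace a d e k (nodeSpace δ u v (3 * k)))
    (hB : ∀ (f g : W) (q r : ℝ[X]), IsRep k (f : CoordRing (curve a d e)) q →
      IsRep k (g : CoordRing (curve a d e)) r → B f g = l (q * r))
    (hsurj : ∀ q ∈ nodeSpace δ u v (3 * k), ∃ f : CoordRing (curve a d e), IsRep k f q)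
    (hpos : IsPos B) :
    formRank B = formRank (B.restrict
        ((repSpace a d e k (nodeSpace δ u v (3 * k - 1))).submoduleOf W)) ↔
      ∃ q ∈ nodeSpace δ u v (3 * k), q.coeff (3 * k) ≠ 0 ∧
        ∀ r ∈ nodeSpace δ u v (3 * k), l (q * r) = 0 := by
  subst hW
  have := finiteDimensional_repSpace (δ := δ) (u := u) (v := v) hP k (3 * k)
  have hlow : ∀ (f : CoordRing (curve a d e)) (q : ℝ[X]), q ∈ nodeSpace δ u v (3 * k) →
      IsRep k f q →
      (f ∈ repSpace a d e k (nodeSpace δ u v (3 * k - 1)) ↔ q.coeff (3 * k) = 0) := by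
    intro f q hq hf
    constructor
    · rintro ⟨r, hr, hfr⟩
      have h1 := hr.1
      rw [hf.rep_unique hfr]
      exact coeff_eq_zero_of_natDegree_lt (by omega)
    · intro h
      refine ⟨q, ⟨?_, hq.2⟩, hf⟩
      rw [natDegree_le_iff_coeff_eq_zero]
      intro N hN
      rcases (show 3 * k ≤ N by omega).eq_or_lt with rfl | hN
      · exact h
      · exact coeff_eq_zero_of_natDegree_lt (hq.1.trans_lt hN)
  rw [formRank_eq_restrict_iff_exists _ hpos]
  · constructor
    · rintro ⟨f, hf, hf'⟩
      obtain ⟨q, hq, hfq⟩ := f.2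
      refine ⟨q, hq, fun h => hf' ((hlow f q hq hfq).2 h), fun r hr => ?_⟩
      obtain ⟨g, hg⟩ := hsurj r hr
      rw [← hB f ⟨g, r, hr, hg⟩ q r hfq hg, LinearMap.mem_ker.1 hf, LinearMap.zero_apply]
    · rintro ⟨q, hq, hqc, hq0⟩
      obtain ⟨f, hf⟩ := hsurj q hq
      refine ⟨⟨f, q, hq, hf⟩, LinearMap.mem_ker.2 (LinearMap.ext fun g => ?_),
        fun h => hqc ((hlow f q hq hf).1 h)⟩
      obtain ⟨r, hr, hg⟩ := g.2
      rw [hB _ g q r hf hg, hq0 r hr, LinearMap.zero_apply]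
  · intro x hx y
    obtain ⟨q, hq, hxq⟩ := x.2
    obtain ⟨r, hr, hyr⟩ := y.2
    have hqc : q.coeff (3 * k) ≠ 0 := fun h => hx ((hlow x q hq hxq).2 h)
    refine ⟨r.coeff (3 * k) / q.coeff (3 * k), ?_⟩
    refine (hlow _ (r - (r.coeff (3 * k) / q.coeff (3 * k)) • q)
      (Submodule.sub_mem _ hr (Submodule.smul_mem _ _ hq)) (hyr.sub (hxq.smul _))).2 ?_
    rw [coeff_sub, coeff_smul, smul_eq_mul, div_mul_cancel₀ _ hqc, sub_self]
  · obtain ⟨q, hq, hr⟩ := cy_pow_isRep (a := a) (e := e) k u v hk hd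
    exact ⟨⟨cy a d e ^ k, q, nodeSpace_mono (by omega) hq, hr⟩, fun h => cy_pow_notMem hk u v h⟩
  · intro f g
    obtain ⟨q, hq, hf⟩ := f.2
    obtain ⟨r, hr, hg⟩ := g.2
    rw [hB f g q r hf hg, hB g f r q hg hf, mul_comm]

end Forms

/-! ### The forms of L on ℝ[C]_{≤ k} and V^(k) in terms of numerators -/

section CurveForms

variable {a d e δ : ℝ} {k : ℕ} {L : polyDeg (2 * k) →ₗ[ℝ] ℝ} {l : ℝ[X] →ₗ[ℝ] ℝ}

theorem coordForm_eq (hl : Represents a d e L l) (hL : VanishesOnIdeal (curve a d e) L)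
    (f g : coordDeg (curve a d e) k) (q r : ℝ[X]) (hf : IsRep k (f : CoordRing (curve a d e)) q)
    (hg : IsRep k (g : CoordRing (curve a d e)) r) :
    coordForm (curve a d e) L hL f g = l (q * r) :=
  inducedFunctional_eq hl hL _ (hf.mul_self_index hg)

theorem localForm_eq (hk : 1 ≤ k) (hl : Represents a d e L l)
    (hL : VanishesOnIdeal (curve a d e) L)
    (f g : spaceV a d e k) (q r : ℝ[X]) (hf : IsRep k (f : CoordRing (curve a d e)) q)
    (hg : IsRep k (g : CoordRing (curve a d e)) r) :
    localForm a d e hk L hL f g = l (q * r) :=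
  inducedFunctional_eq hl hL _ (hf.mul_self_index hg)

theorem isPos_coordForm_iff (hP : Irreducible (cubic a d e)) (hδ : δ ≠ 0) (hd : δ ^ 2 = d)
    (hk : 1 ≤ k) (hl : Represents a d e L l) (hL : VanishesOnIdeal (curve a d e) L) :
    IsPos (coordForm (curve a d e) L hL) ↔
      ∀ q ∈ nodeSpace δ ((num a e).eval δ ^ k) ((num a e).eval (-δ) ^ k) (3 * k),
        0 ≤ l (q * q) :=
  isPos_iff_of_isRep (coordDeg_eq_repSpace hP hδ hd hk) (coordForm_eq hl hL)
    fun _ hq => exists_isRep_coord hP hδ hd hk hq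

theorem isPos_localForm_iff (hP : Irreducible (cubic a d e)) (hδ : δ ≠ 0) (hd : δ ^ 2 = d)
    (hk : 1 ≤ k) (hl : Represents a d e L l) (hL : VanishesOnIdeal (curve a d e) L) :
    IsPos (localForm a d e hk L hL) ↔
      ∀ q ∈ nodeSpace δ ((num a e).eval δ ^ k) (-(num a e).eval (-δ) ^ k) (3 * k),
        0 ≤ l (q * q) :=
  isPos_iff_of_isRep (spaceV_eq_repSpace hP hδ hd hk) (localForm_eq hk hl hL)
    fun _ hq => exists_isRep_local hP hδ hd hk hq

theorem rankCondition_iff (hP : Irreducible (cubic a d e)) (hδ : δ ≠ 0) (hd : δ ^ 2 = d)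
    (hk : 1 ≤ k) (hl : Represents a d e L l) (hL : VanishesOnIdeal (curve a d e) L)
    (h1 : IsPos (coordForm (curve a d e) L hL)) (h2 : IsPos (localForm a d e hk L hL)) :
    RankCondition a d e hk L hL ↔
      (∃ q ∈ nodeSpace δ ((num a e).eval δ ^ k) ((num a e).eval (-δ) ^ k) (3 * k),
        q.coeff (3 * k) ≠ 0 ∧ ∀ r ∈ nodeSpace δ ((num a e).eval δ ^ k)
          ((num a e).eval (-δ) ^ k) (3 * k), l (q * r) = 0) ∨
      ∃ q ∈ nodeSpace δ ((num a e).eval δ ^ k) (-(num a e).eval (-δ) ^ k) (3 * k),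
        q.coeff (3 * k) ≠ 0 ∧ ∀ r ∈ nodeSpace δ ((num a e).eval δ ^ k)
          (-(num a e).eval (-δ) ^ k) (3 * k), l (q * r) = 0 := by
  unfold RankCondition
  rw [span_basisB_diff hP hδ hd hk, span_basisBt_diff hP hδ hd hk]
  exact or_congr
    (formRank_eq_iff_of_isRep hP hd hk (coordDeg_eq_repSpace hP hδ hd hk) (coordForm_eq hl hL)
      (fun _ hq => exists_isRep_coord hP hδ hd hk hq) h1)
    (formRank_eq_iff_of_isRep hP hd hk (spaceV_eq_repSpace hP hδ hd hk) (localForm_eq hk hl hL)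
      (fun _ hq => exists_isRep_local hP hδ hd hk hq) h2)

/-- Elements of a kernel are isotropic, so without nonzero isotropic numerators both kernels would
be as small as possible. No positivity is needed in this direction. -/
theorem exists_ne_zero_of_singular (hP : Irreducible (cubic a d e)) (hδ : δ ≠ 0)
    (hd : δ ^ 2 = d) (hk : 1 ≤ k) (hl : Represents a d e L l)
    (hL : VanishesOnIdeal (curve a d e) L) (hsing : ¬ IsNonsingular a d e hk L hL) :
    ∃ q : ℝ[X], (q ∈ nodeSpace δ ((num a e).eval δ ^ k) ((num a e).eval (-δ) ^ k) (3 * k) ∨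
      q ∈ nodeSpace δ ((num a e).eval δ ^ k) (-(num a e).eval (-δ) ^ k) (3 * k)) ∧
      q ≠ 0 ∧ l (q * q) = 0 := by
  by_contra! hc
  have hzero : ∀ {f : CoordRing (curve a d e)}, IsRep k f 0 → f = 0 := fun hf =>
    hf.fun_unique hP IsRep.zero
  refine hsing ⟨fun f => ⟨fun hf => ?_, fun hf => ?_⟩, ?_⟩
  · have hf1 : (Ideal.Quotient.mk _ (f : MvPolynomial (Fin 2) ℝ) : CoordRing (curve a d e)) ∈
        coordDeg (curve a d e) k :=
      mk_mem_coordDeg _ _ ((MvPolynomial.mem_restrictTotalDegree _ _ _).1 f.2)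
    rw [coordDeg_eq_repSpace hP hδ hd hk] at hf1
    obtain ⟨q, hq, hfq⟩ := hf1
    have h1 : l (q * q) = 0 := by
      rw [hl ⟨f * f, polyDeg_mul k f f.2 f f.2⟩ (q * q) (by
        rw [map_mul]
        exact hfq.mul_self_index hfq)]
      exact LinearMap.congr_fun (LinearMap.mem_ker.1 hf) f
    have h2 : q = 0 := by
      by_contra h0
      exact hc q (Or.inl hq) h0 h1
    rw [h2] at hfq
    exact Ideal.Quotient.eq_zero_iff_mem.1 (hzero hfq)
  · refine LinearMap.mem_ker.2 (LinearMap.ext fun g => ?_)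
    exact hL _ (Ideal.mul_mem_right _ _ hf)
  · refine (Submodule.eq_bot_iff _).2 fun f hf => ?_
    have hf1 := (spaceV_eq_repSpace hP hδ hd hk).le f.2
    obtain ⟨q, hq, hfq⟩ := hf1
    have h1 : l (q * q) = 0 := by
      rw [← localForm_eq hk hl hL f f q q hfq hfq, LinearMap.mem_ker.1 hf]
      rfl
    have h2 : q = 0 := by
      by_contra h0
      exact hc q (Or.inr hq) h0 h1
    rw [h2] at hfq
    exact Subtype.ext (hzero hfq)

end CurveForms

/-! ### Measures on the curve -/

section Moments

variable {a d e δ : ℝ} {k : ℕ} {L : polyDeg (2 * k) →ₗ[ℝ] ℝ} {l : ℝ[X] →ₗ[ℝ] ℝ}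

theorem isMomentFunctional_of_atomic (hl : Represents a d e L l) {S : Finset ℝ} {w : ℝ → ℝ}
    (hw : ∀ t ∈ S, 0 ≤ w t) (hS : ∀ t ∈ S, t ^ 2 ≠ d)
    (h : ∀ Q : ℝ[X], Q.natDegree ≤ 3 * (2 * k) → l Q = atomic S w Q) :
    IsMomentFunctional (curve a d e) L := by
  -- The factor (t² - d)^(2k) converts the value of the numerator into the value of p at the point;
  -- its exponent is even, so the masses are nonnegative.
  refine ⟨∑ t ∈ S, ENNReal.ofReal (w t * (t ^ 2 - d) ^ (2 * k)) •
    Measure.dirac (curvePoint a d e t), ?_, fun p => ?_⟩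
  · rw [Measure.finsetSum_apply]
    refine Finset.sum_eq_zero fun t ht => ?_
    rw [Measure.smul_apply, Measure.dirac_apply,
      Set.indicator_of_notMem (Set.notMem_compl_iff.2 (curvePoint_mem a e (hS t ht))), smul_zero]
  have hint : ∀ t ∈ S, Integrable
      (fun z => MvPolynomial.eval z (p : MvPolynomial (Fin 2) ℝ))
      (ENNReal.ofReal (w t * (t ^ 2 - d) ^ (2 * k)) • Measure.dirac (curvePoint a d e t)) :=
    fun t _ => (integrable_dirac (by simp)).smul_measure ENNReal.ofReal_ne_top
  refine ⟨integrable_finsetSum_measure.2 hint, ?_⟩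
  rw [integral_finsetSum_measure hint]
  obtain ⟨Q, hQ, hr⟩ := exists_isRep_polyDeg (a := a) (d := d) (e := e) p
  rw [← hl p Q hr, h Q hQ, atomic_apply]
  refine Finset.sum_congr rfl fun t ht => ?_
  have hnn : 0 ≤ w t * (t ^ 2 - d) ^ (2 * k) :=
    mul_nonneg (hw t ht) (by rw [pow_mul]; positivity)
  rw [integral_smul_measure, integral_dirac, ENNReal.toReal_ofReal hnn, ← hr.eval_eq (hS t ht),
    smul_eq_mul]
  ring

theorem pow_sq_eq (x : ℝ) (k : ℕ) : (x ^ k) ^ 2 = x ^ (2 * k) := by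
  rw [← pow_mul, mul_comm]

theorem exists_isRep_polyDeg_of_mem (hP : Irreducible (cubic a d e)) (hδ : δ ≠ 0)
    (hd : δ ^ 2 = d) (hk : 1 ≤ k) {Q : ℝ[X]}
    (hQ : Q ∈ nodeSpace δ (((num a e).eval δ ^ k) ^ 2) (((num a e).eval (-δ) ^ k) ^ 2)
      (2 * (3 * k))) : ∃ p : polyDeg (2 * k), IsRep (a := a) (d := d) (e := e) (2 * k)
        (Ideal.Quotient.mk _ (p : MvPolynomial (Fin 2) ℝ)) Q := by
  rw [pow_sq_eq, pow_sq_eq, show 2 * (3 * k) = 3 * (2 * k) by ring] at hQ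
  obtain ⟨f, hf⟩ := exists_isRep_coord hP hδ hd (by omega) hQ
  have hf' : f ∈ coordDeg (curve a d e) (2 * k) := by
    rw [coordDeg_eq_repSpace hP hδ hd (by omega)]
    exact ⟨Q, hQ, hf⟩
  obtain ⟨p, hp, rfl⟩ := mem_coordDeg _ hf'
  exact ⟨⟨p, (MvPolynomial.mem_restrictTotalDegree _ _ _).2 hp⟩, hf⟩

theorem sq_mem_nodeSpace {u v : ℝ} {n : ℕ} {q : ℝ[X]}
    (hq : q ∈ nodeSpace δ u v n ∨ q ∈ nodeSpace δ u (-v) n) :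
    q * q ∈ nodeSpace δ (u ^ 2) (v ^ 2) (2 * n) :=
  hq.elim (fun h => mul_mem_nodeSpace_sq h h) fun h => mul_mem_nodeSpace_sq_of_neg h h

theorem eval_curve_nonneg (hP : Irreducible (cubic a d e)) {p : MvPolynomial (Fin 2) ℝ}
    {q : ℝ[X]} (hp : IsRep (a := a) (d := d) (e := e) (2 * k) (Ideal.Quotient.mk _ p) (q * q))
    {z : Fin 2 → ℝ} (hz : z ∈ curve a d e) :
    0 ≤ MvPolynomial.eval z p ∧ (MvPolynomial.eval z p = 0 → q.eval (z 1) = 0) := by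
  have h1 := sq_ne_of_mem_curve hP hz
  have h2 := hp.eval_eq h1
  rw [← eq_curvePoint hP hz, eval_mul] at h2
  have h3 : 0 < (z 1 ^ 2 - d) ^ (2 * k) := by
    have := sub_ne_zero.2 h1
    rw [pow_mul]
    positivity
  constructor
  · by_contra! hc
    nlinarith [mul_self_nonneg (q.eval (z 1)), mul_neg_of_neg_of_pos hc h3]
  · intro h
    rw [h, zero_mul] at h2
    exact mul_self_eq_zero.1 h2.symm

theorem IsMomentFunctional.nonneg (hP : Irreducible (cubic a d e)) (hδ : δ ≠ 0)
    (hd : δ ^ 2 = d) (hk : 1 ≤ k) (hl : Represents a d e L l)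
    (hL : IsMomentFunctional (curve a d e) L) {q : ℝ[X]}
    (hq : q ∈ nodeSpace δ ((num a e).eval δ ^ k) ((num a e).eval (-δ) ^ k) (3 * k) ∨
      q ∈ nodeSpace δ ((num a e).eval δ ^ k) (-(num a e).eval (-δ) ^ k) (3 * k)) :
    0 ≤ l (q * q) := by
  obtain ⟨μ, hμ, hint⟩ := hL
  obtain ⟨p, hp⟩ := exists_isRep_polyDeg_of_mem hP hδ hd hk (sq_mem_nodeSpace hq)
  rw [hl p _ hp, (hint p).2]
  have hae : ∀ᵐ z ∂μ, z ∈ curve a d e := hμ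
  exact integral_nonneg_of_ae (hae.mono fun z hz => (eval_curve_nonneg hP hp hz).1)

/-- The integrand with numerator q² is nonnegative on the curve and has integral zero, so μ is
carried by the finitely many curve points whose parameter is a root of q. -/
theorem IsMomentFunctional.exists_atomic (hP : Irreducible (cubic a d e)) (hδ : δ ≠ 0)
    (hd : δ ^ 2 = d) (hk : 1 ≤ k) (hl : Represents a d e L l)
    (hL : IsMomentFunctional (curve a d e) L) {q : ℝ[X]}
    (hq : q ∈ nodeSpace δ ((num a e).eval δ ^ k) ((num a e).eval (-δ) ^ k) (3 * k) ∨
      q ∈ nodeSpace δ ((num a e).eval δ ^ k) (-(num a e).eval (-δ) ^ k) (3 * k))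
    (hq0 : q ≠ 0) (hqq : l (q * q) = 0) :
    ∃ (S : Finset ℝ) (w : ℝ → ℝ), (∀ t ∈ S, 0 < w t) ∧ (∀ t ∈ S, t ^ 2 ≠ d) ∧
      (∀ t ∈ S, q.eval t = 0) ∧
      ∀ Q ∈ nodeSpace δ (((num a e).eval δ ^ k) ^ 2) (((num a e).eval (-δ) ^ k) ^ 2)
        (2 * (3 * k)), l Q = atomic S w Q := by
  classical
  obtain ⟨μ, hμ, hint⟩ := hL
  have hae : ∀ᵐ z ∂μ, z ∈ curve a d e := hμ
  obtain ⟨p, hp⟩ := exists_isRep_polyDeg_of_mem hP hδ hd hk (sq_mem_nodeSpace hq)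
  rw [hl p _ hp, (hint p).2, integral_eq_zero_iff_of_nonneg_ae
    (hae.mono fun z hz => (eval_curve_nonneg hP hp hz).1) (hint p).1] at hqq
  set S₀ : Finset ℝ := q.roots.toFinset.filter fun t => t ^ 2 ≠ d with hS₀
  have hinj : Function.Injective (curvePoint a d e) := fun s t h => congrFun h 1
  have hZ : ∀ᵐ z ∂μ, z ∈ ((S₀.image (curvePoint a d e) : Finset (Fin 2 → ℝ)) :
      Set (Fin 2 → ℝ)) := by
    filter_upwards [hae, hqq] with z hz hz0
    rw [Finset.mem_coe, Finset.mem_image]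
    refine ⟨z 1, ?_, (eq_curvePoint hP hz).symm⟩
    rw [hS₀, Finset.mem_filter, Multiset.mem_toFinset, mem_roots hq0]
    exact ⟨(eval_curve_nonneg hP hp hz).2 hz0, sq_ne_of_mem_curve hP hz⟩
  set w : ℝ → ℝ := fun t => μ.real {curvePoint a d e t} / (t ^ 2 - d) ^ (2 * k) with hw
  have hw0 : ∀ t, 0 ≤ w t := fun t =>
    div_nonneg measureReal_nonneg (by rw [pow_mul]; positivity)
  -- Points without mass are dropped: strictly positive weights are needed for the nodal polynomial
  -- to be a minimal kernel element.
  refine ⟨S₀.filter fun t => 0 < w t, w, fun t ht => (Finset.mem_filter.1 ht).2, fun t ht => ?_,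
    fun t ht => ?_, fun Q hQ => ?_⟩
  · exact (Finset.mem_filter.1 (Finset.mem_filter.1 ht).1).2
  · have := (Finset.mem_filter.1 (Finset.mem_filter.1 ht).1).1
    rw [Multiset.mem_toFinset, mem_roots hq0] at this
    exact this
  obtain ⟨r, hr⟩ := exists_isRep_polyDeg_of_mem hP hδ hd hk hQ
  rw [hl r Q hr, (hint r).2, ← Measure.restrict_eq_self_of_ae_mem hZ,
    setIntegral_finset _ (hint r).1.integrableOn, Finset.sum_image fun s _ t _ h => hinj h,
    atomic_apply, Finset.sum_filter fun t => 0 < w t]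
  refine Finset.sum_congr rfl fun t ht => ?_
  have h1 : t ^ 2 ≠ d := (Finset.mem_filter.1 ht).2
  have h2 : (t ^ 2 - d) ^ (2 * k) ≠ 0 := pow_ne_zero _ (sub_ne_zero.2 h1)
  have h3 : μ.real {curvePoint a d e t} = w t * (t ^ 2 - d) ^ (2 * k) :=
    (div_mul_cancel₀ _ h2).symm
  have h4 : w t * Q.eval t = if 0 < w t then w t * Q.eval t else 0 := by
    split_ifs with h
    · rfl
    · rw [le_antisymm (not_lt.1 h) (hw0 t), zero_mul]
  rw [← h4, h3, ← hr.eval_eq h1, smul_eq_mul]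
  ring

end Moments

/-! ### From a generating polynomial to a measure -/

section Conclusion

variable {a d e δ : ℝ} {k : ℕ} {L : polyDeg (2 * k) →ₗ[ℝ] ℝ} {l : ℝ[X] →ₗ[ℝ] ℝ}

/-- Numerators of ℝ[C]_{≤ 2k} satisfy the node condition with the squared ratios, so only the values
on that hyperplane count. -/
theorem Represents.congr (hd : δ ^ 2 = d) (hk : 1 ≤ k) (hl : Represents a d e L l)
    {l' : ℝ[X] →ₗ[ℝ] ℝ}
    (h : ∀ Q ∈ nodeSpace δ (((num a e).eval δ ^ k) ^ 2) (((num a e).eval (-δ) ^ k) ^ 2)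
      (2 * (3 * k)), l' Q = l Q) : Represents a d e L l' := by
  intro p Q hQ
  rw [← hl p Q hQ]
  apply h
  obtain ⟨q, hq, hr⟩ := coordDeg_le_repSpace (a := a) (e := e) hd (k := 2 * k) (by omega)
    (mk_mem_coordDeg _ _ ((MvPolynomial.mem_restrictTotalDegree _ _ _).1 p.2))
  rw [hQ.rep_unique hr, pow_sq_eq, pow_sq_eq, show 2 * (3 * k) = 3 * (2 * k) by ring]
  exact hq

theorem isMomentFunctional_of_isMinimalKernel (hd : δ ^ 2 = d) (hk : 1 ≤ k)
    (hl : Represents a d e L l)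
    (hpos : ∀ q : ℝ[X], q.natDegree ≤ 3 * k → 0 ≤ l (q * q)) {p : ℝ[X]}
    (hp : IsMinimalKernel l (3 * k) p) (h1 : p.eval δ ≠ 0) (h2 : p.eval (-δ) ≠ 0) {q : ℝ[X]}
    (hq : q.natDegree ≤ 3 * k) (hqc : q.coeff (3 * k) ≠ 0) (hqq : l (q * q) = 0) :
    IsMomentFunctional (curve a d e) L := by
  obtain ⟨w, c, hw, hc, h⟩ := hp.exists_quadrature (by omega) hpos
  -- At q², both the sum over the nodes and c times the squared leading coefficient of q are
  -- nonnegative, and they add up to zero.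
  have hc0 : c = 0 := by
    have h3 := h (q * q) (natDegree_mul_le.trans (by omega))
    have h4 : 0 ≤ ∑ t ∈ p.roots.toFinset, w t * (q * q).eval t :=
      Finset.sum_nonneg fun t _ => mul_nonneg (hw t) (by rw [eval_mul]; exact mul_self_nonneg _)
    rw [hqq, two_mul (3 * k), coeff_mul_add_eq_of_natDegree_le hq hq] at h3
    have h5 : 0 < q.coeff (3 * k) * q.coeff (3 * k) := mul_self_pos.2 hqc
    by_contra hne
    have := mul_pos (lt_of_le_of_ne hc (Ne.symm hne)) h5
    linarith
  refine isMomentFunctional_of_atomic hl (S := p.roots.toFinset) (w := w) (fun t _ => hw t)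
    (fun t ht htd => ?_) fun Q hQ => ?_
  · rw [Multiset.mem_toFinset, mem_roots hp.2.1] at ht
    rw [← hd] at htd
    rcases sq_eq_sq_iff_eq_or_eq_neg.1 htd with rfl | rfl
    exacts [h1 ht, h2 ht]
  · rw [h Q (by omega), hc0, zero_mul, add_zero, atomic_apply]

end Conclusion

end CubicTMP

end

/-! ### The equivalence -/

open CubicTMP in
theorem theorem4p6 (a d e : ℝ) (hd : 0 < d) (hP : Irreducible (CubicTMP.cubic a d e))
    (k : ℕ) (hk : 1 ≤ k) (L : CubicTMP.polyDeg (2 * k) →ₗ[ℝ] ℝ)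
    (hL : CubicTMP.VanishesOnIdeal (CubicTMP.curve a d e) L)
    (hsing : ¬ CubicTMP.IsNonsingular a d e hk L hL) :
    List.TFAE [
      CubicTMP.IsMomentFunctional (CubicTMP.curve a d e) L,
      CubicTMP.IsPos (CubicTMP.coordForm (CubicTMP.curve a d e) L hL) ∧
        CubicTMP.IsPos (CubicTMP.localForm a d e hk L hL) ∧
        (∃ Lhat : CubicTMP.rrSpace d (2 * k) →ₗ[ℝ] ℝ,
          CubicTMP.IsExtension a d e L Lhat ∧ CubicTMP.IsPos (CubicTMP.rrForm d Lhat) ∧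
            CubicTMP.GeneratingNonvanishing d (CubicTMP.uniFunctional d Lhat)) ∧
        CubicTMP.RankCondition a d e hk L hL,
      CubicTMP.IsPos (CubicTMP.coordForm (CubicTMP.curve a d e) L hL) ∧
        CubicTMP.IsPos (CubicTMP.localForm a d e hk L hL) ∧
        (∀ Lhat : CubicTMP.rrSpace d (2 * k) →ₗ[ℝ] ℝ,
          CubicTMP.IsExtension a d e L Lhat → CubicTMP.IsPos (CubicTMP.rrForm d Lhat) →
            CubicTMP.GeneratingNonvanishing d (CubicTMP.uniFunctional d Lhat)) ∧
        CubicTMP.RankCondition a d e hk L hL] := by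
  have hδ : Real.sqrt d ≠ 0 := (Real.sqrt_pos.2 hd).ne'
  have hδd : Real.sqrt d ^ 2 = d := Real.sq_sqrt hd.le
  have hu := pow_ne_zero k (eval_num_ne_zero hP hδd)
  have hv := pow_ne_zero k (eval_num_ne_zero hP ((neg_sq _).trans hδd))
  obtain ⟨l₀, hl₀⟩ := exists_represents hP hL
  tfae_have 1 → 3 := by
    intro hmom
    obtain ⟨q, hq, hq0, hqq⟩ := exists_ne_zero_of_singular hP hδ hδd hk hl₀ hL hsing
    obtain ⟨S, w, hw, hS, hqS, hlS⟩ := hmom.exists_atomic hP hδ hδd hk hl₀ hq hq0 hqq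
    have h1S : Real.sqrt d ∉ S := fun h => hS _ h hδd
    have h2S : -Real.sqrt d ∉ S := fun h => hS _ h ((neg_sq _).trans hδd)
    have hA := (isPos_coordForm_iff hP hδ hδd hk hl₀ hL).2 fun q hq =>
      hmom.nonneg hP hδ hδd hk hl₀ (Or.inl hq)
    have hB := (isPos_localForm_iff hP hδ hδd hk hl₀ hL).2 fun q hq =>
      hmom.nonneg hP hδ hδd hk hl₀ (Or.inr hq)
    refine ⟨hA, hB, fun Lhat hext hpos => ?_, ?_⟩
    · obtain ⟨l, hl⟩ := exists_extend_uniFunctional Lhat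
      have hlr := (isExtension_iff hl).1 hext
      have hlpos := (isPos_rrForm_iff hl).1 hpos
      have hlS' : ∀ Q ∈ nodeSpace (Real.sqrt d) (((num a e).eval (Real.sqrt d) ^ k) ^ 2)
          (((num a e).eval (-Real.sqrt d) ^ k) ^ 2) (2 * (3 * k)), l Q = atomic S w Q := by
        intro Q hQ
        obtain ⟨p, hp⟩ := exists_isRep_polyDeg_of_mem hP hδ hδd hk hQ
        rw [← hlS Q hQ, hlr p Q hp, hl₀ p Q hp]
      -- The given extension is arbitrary; rigidity forces it to be the atomic functional in all
      -- degrees up to 6 k.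
      have hat := eq_atomic_of_eq_on_nodeSpace hδ hu hv (by omega) h1S h2S hlpos hlS' hq hq0 hqS
      have hcard : S.card ≤ 3 * k := (card_le_natDegree_of_eval_eq_zero hq0 hqS).trans
        (hq.elim (fun h => h.1) fun h => h.1)
      exact (generatingNonvanishing_iff hl).2 ⟨_, isMinimalKernel_nodal hw hcard hat,
        eval_nodal_ne_zero h1S, eval_nodal_ne_zero h2S⟩
    · rw [rankCondition_iff hP hδ hδd hk hl₀ hL hA hB]
      refine (exists_coeff_ne_zero_of_vanishing hδ hv h1S hq hq0 hqS).imp ?_ ?_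
      · rintro ⟨f, hf, hfc, hfS⟩
        exact ⟨f, hf, hfc, fun r hr => by
          rw [hlS _ (mul_mem_nodeSpace_sq hf hr), atomic_mul_eq_zero hfS]⟩
      · rintro ⟨f, hf, hfc, hfS⟩
        exact ⟨f, hf, hfc, fun r hr => by
          rw [hlS _ (mul_mem_nodeSpace_sq_of_neg hf hr), atomic_mul_eq_zero hfS]⟩
  -- The universal statement could be vacuous; the completion lemma supplies a square positive
  -- extension to which it applies.
  tfae_have 3 → 2 := by
    rintro ⟨hA, hB, hall, hrank⟩
    refine ⟨hA, hB, ?_, hrank⟩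
    obtain ⟨l, hl, hpos⟩ := exists_square_positive_completion hδ hu hv (n := 3 * k) (by omega) l₀
      ((isPos_coordForm_iff hP hδ hδd hk hl₀ hL).1 hA)
      ((isPos_localForm_iff hP hδ hδd hk hl₀ hL).1 hB)
    obtain ⟨Lhat, hLhat⟩ := exists_uniFunctional_eq d k l
    have hext := (isExtension_iff hLhat).2 (hl₀.congr hδd hk hl)
    have hLpos := (isPos_rrForm_iff hLhat).2 hpos
    exact ⟨Lhat, hext, hLpos, hall Lhat hext hLpos⟩
  tfae_have 2 → 1 := by
    rintro ⟨hA, hB, ⟨Lhat, hext, hpos, hgen⟩, hrank⟩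
    obtain ⟨l, hl⟩ := exists_extend_uniFunctional Lhat
    have hlr := (isExtension_iff hl).1 hext
    obtain ⟨p, hp, h1, h2⟩ := (generatingNonvanishing_iff hl).1 hgen
    have hlpos := (isPos_rrForm_iff hl).1 hpos
    rcases (rankCondition_iff hP hδ hδd hk hlr hL hA hB).1 hrank with
      ⟨q, hq, hqc, hq0⟩ | ⟨q, hq, hqc, hq0⟩
    · exact isMomentFunctional_of_isMinimalKernel hδd hk hlr hlpos hp h1 h2 hq.1 hqc (hq0 q hq)
    · exact isMomentFunctional_of_isMinimalKernel hδd hk hlr hlpos hp h1 h2 hq.1 hqc (hq0 q hq)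
  tfae_finish
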